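/- **Theorem 2 (Necessity).** *Conventions.* Identify an index $z\in\{0,\dots,2^m-1\}$ with the vector $a=(a_1,\dots,a_m)\in\mathbb F_2^m$ such that $z=\sum_{i=1}^m 2^{i-1}(1-a_i)$, and with the monomial $x_1^{a_1}\cdots x_m^{a_m}$. For $\mathcal I\subseteq\mathbb F_2^m$ with complement $\mathcal F$, let $C(\mathcal I)\subseteq\mathbb F_2^{2^m}$ be the polar code spanned by the rows with index in $\mathcal I$ of $G_m=\begin{bmatrix}1&0\\1&1\end{bmatrix}^{\otimes m}$. The set $\mathcal I$ is decreasing if $f\in\mathcal I$ and $g\preccurlyeq f$ imply $g\in\mathcal I$; here $x_{i_1}\cdots x_{i_t}\preccurlyeq x_{j_1}\cdots x_{j_t}$ (with $i_1<\dots<i_t$, $j_1<\dots<j_t$) iff $i_l\le j_l$ for all $l$, and in general $f\preccurlyeq g$ iff $f\preccurlyeq g'$ for a divisor $g'$ of $g$ with $\deg g'=\deg f$. A permutation $\pi$ of the indices acts on vectors by $\pi(c)=(c_{\pi(0)},\dots,c_{\pi(2^m-1)})$; it is an automorphism of $C(\mathcal I)$ if $\pi(c)\in C(\mathcal I)$ for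 all $c\in C(\mathcal I)$. For an invertible binary $m\times m$ matrix $M$, $\varphi(M)$ is the permutation $a\mapsto Ma$. Write $s(M)=\langle s_1,\dots,s_l\rangle$ if $M$ is block lower-triangular with full-rank diagonal blocks of sizes $s_1,\dots,s_l\ge1$, none of which can be written as a block lower-triangular matrix with more than one block. $\mathrm{SC}_{\mathcal I}:\mathbb R^{2^m}\to\mathbb F_2^{2^m}$ is the successive cancellation decoder. From the input LLRs $L_{i,m}$ it computes, for $0\le t<m$ and all $i$ whose binary digit of weight $2^t$ is $0$, $$L_{i,t}=\log\frac{e^{L_{i,t+1}+L_{i+2^t,t+1}}+1}{e^{L_{i,t+1}}+e^{L_{i+2^t,t+1}}},\qquad L_{i+2^t,t}=(-1)^{u_{i,t}}L_{i,t+1}+L_{i+2^t,t+1},$$ $$u_{i,t+1}=u_{i,t}\oplus u_{i+2^t,t},\qquad u_{i+2^t,t+1}=u_{i+2^t,t},$$ where $u_{i,0}=1$ if $i\in\mathcal I$ and $L_{i,0}<0$, and $u_{i,0}=0$ otherwise; the output is $(u_{i,m})_i$. A permutation $\pi$ commutes with $\mathrm{SC}_{\mathcal I}$ if $\mathrm{SC}_{\mathcal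 I}(\pi(y))=\pi(\mathrm{SC}_{\mathcal I}(y))$ for all $y\in\mathbb R^{2^m}$. $\mathrm{DecAut}(\langle s_1,\dots,s_l\rangle,\mathcal I)$, for $\mathcal I\subseteq\mathbb F_2^m$ and $m=s_1+\dots+s_l$, is the following recursive algorithm. Let $S=s_1+\dots+s_{l-1}$, $A_1=\{a: a_{S+1}=\dots=a_m=1\}$, $A_2=\{a: a_{S+1}=\dots=a_m=0\}$, and let $\mathcal I(A_j)\subseteq\mathbb F_2^{S}$ consist of the vectors $(a_1,\dots,a_S)$ with $a\in\mathcal I\cap A_j$. - If $l=1$, output TRUE iff $\mathcal F\subseteq A_1$ or $\mathcal I\subseteq A_2$. - If $l>1$ and $s_l=1$, output $\mathrm{DecAut}(\langle s_1,\dots,s_{l-1}\rangle,\mathcal I(A_1))\wedge\mathrm{DecAut}(\langle s_1,\dots,s_{l-1}\rangle,\mathcal I(A_2))$. - If $l>1$ and $s_l>1$, output $\mathrm{DecAut}(\langle s_1,\dots,s_{l-1}\rangle,\mathcal I(A_1))$ if $\mathcal F\subseteq A_1$; otherwise $\mathrm{DecAut}(\langle s_1,\dots,s_{l-1}\rangle,\mathcal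 I(A_2))$ if $\mathcal I\subseteq A_2$; otherwise FALSE. *Statement.* Let $\mathcal I\subseteq\mathbb F_2^m$ be decreasing, let $M$ be an invertible binary $m\times m$ matrix with $s(M)=\langle s_1,\dots,s_l\rangle$, and suppose that $\pi=\varphi(M)$ is an automorphism of $C(\mathcal I)$. If $\pi$ commutes with $\mathrm{SC}_{\mathcal I}$, then $\mathrm{DecAut}(s(M),\mathcal I)$ outputs TRUE. The same conclusion holds if $\mathrm{SC}_{\mathcal I}(\pi(y))=\pi(\mathrm{SC}_{\mathcal I}(y))$ is only assumed for Lebesgue-almost every $y\in\mathbb R^{2^m}$. -/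

import Mathlib

open MeasureTheory

/-- Bit vectors `(a_1, …, a_m) ∈ 𝔽₂^m`, the coordinate `a_{i+1}` being `a i`.  The vector `a` stands
for the index `z ∈ {0, …, 2^m - 1}` with `z = ∑ 2^(i-1) (1 - a_i)` (so `a` is the binary
representation of `2^m - 1 - z`, least significant bit first) and for the monomial
`x_1^{a_1} ⋯ x_m^{a_m}`. -/
abbrev Bits (m : ℕ) : Type := Fin m → ZMod 2

/-! ### Polar codes -/

/-- The kernel `F = [[1, 0], [1, 1]]`. -/
def kernelF : Matrix (ZMod 2) (ZMod 2) (ZMod 2) := !![1, 0; 1, 1]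

/-- The row of `G_m = F^{⊗ m}` whose index is represented by `a`.  An entry of a Kronecker power is
the product of the entries of `F` at the binary digits `1 - a_i`, `1 - b_i` of the row index and of
the column index. -/
def polarRow {m : ℕ} (a : Bits m) : Bits m → ZMod 2 :=
  fun b => ∏ i, kernelF (1 - a i) (1 - b i)

/-- The polar code `C(I)` of length `2^m`: the span of the rows of `G_m` with index in `I`. -/
def polarCode {m : ℕ} (I : Finset (Bits m)) : Submodule (ZMod 2) (Bits m → ZMod 2) :=
  Submodule.span (ZMod 2) (polarRow '' (I : Set (Bits m)))

/-- The set of (positions of) variables that occur in the monomial `x^a`. -/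
def monoSupp {m : ℕ} (a : Bits m) : Finset (Fin m) := Finset.univ.filter fun i => a i = 1

/-- `f ≼ g` for monomials `f = x_{i_1} ⋯ x_{i_t}` and `g = x_{j_1} ⋯ x_{j_t}` of the same degree,
`i_1 < … < i_t`, `j_1 < … < j_t`: it means `i_l ≤ j_l` for all `l`. -/
def MonoLESameDegree {m : ℕ} (f g : Bits m) : Prop :=
  ∃ (t : ℕ) (i j : Fin t → Fin m), StrictMono i ∧ StrictMono j ∧
    monoSupp f = Finset.univ.image i ∧ monoSupp g = Finset.univ.image j ∧ ∀ l, i l ≤ j l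

/-- The order `f ≼ g` on all monomials: `g` has a divisor `g'` of the degree of `f` with
`f ≼ g'`. -/
def MonoLE {m : ℕ} (f g : Bits m) : Prop :=
  ∃ g' : Bits m, monoSupp g' ⊆ monoSupp g ∧ MonoLESameDegree f g'

/-- Decreasing information sets. -/
def IsDecreasing {m : ℕ} (I : Finset (Bits m)) : Prop :=
  ∀ f ∈ I, ∀ g : Bits m, MonoLE g f → g ∈ I

/-! ### Permutations and automorphisms -/

/-- `π(c) = (c_{π(0)}, …, c_{π(n-1)})`. -/
def permute {m : ℕ} {R : Type*} (π : Equiv.Perm (Bits m)) (c : Bits m → R) : Bits m → R :=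
  fun a => c (π a)

/-- `π` is an automorphism of the code `C`. -/
def IsCodeAutomorphism {m : ℕ} (C : Submodule (ZMod 2) (Bits m → ZMod 2))
    (π : Equiv.Perm (Bits m)) : Prop :=
  ∀ c ∈ C, permute π c ∈ C

/-- The permutation `φ(M)` of the indices, `a ↦ M a`. -/
def phi {m : ℕ} (M : GL (Fin m) (ZMod 2)) : Equiv.Perm (Bits m) where
  toFun a := (M : Matrix (Fin m) (Fin m) (ZMod 2)).mulVec a
  invFun a := ((M⁻¹ : GL (Fin m) (ZMod 2)) : Matrix (Fin m) (Fin m) (ZMod 2)).mulVec a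
  left_inv a := by
    beta_reduce
    rw [Matrix.mulVec_mulVec, Units.inv_mul, Matrix.one_mulVec]
  right_inv a := by
    beta_reduce
    rw [Matrix.mulVec_mulVec, Units.mul_inv, Matrix.one_mulVec]

/-! ### Block lower-triangular structure -/

/-- The `k × k` block of `M` on the rows and columns `p, …, p + k - 1` (counted from `0`); it is
only used for `p + k ≤ m`. -/
def diagBlock {m : ℕ} (M : Matrix (Fin m) (Fin m) (ZMod 2)) (p k : ℕ) :
    Matrix (Fin k) (Fin k) (ZMod 2) :=
  fun i j => if h : p + i < m ∧ p + j < m then M ⟨p + i, h.1⟩ ⟨p + j, h.2⟩ else 0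

/-- `M` can be written as a block lower-triangular matrix whose diagonal blocks have the (positive)
sizes `s_1, …, s_l` and have full rank. -/
def IsBlockLowerTriangular {m : ℕ} (s : List ℕ) (M : Matrix (Fin m) (Fin m) (ZMod 2)) : Prop :=
  (∀ k ∈ s, 0 < k) ∧ s.sum = m ∧
  (∀ t ≤ s.length, ∀ i j : Fin m, (i : ℕ) < (s.take t).sum → (s.take t).sum ≤ (j : ℕ) →
    M i j = 0) ∧
  ∀ t : Fin s.length, (diagBlock M (s.take t).sum (s.get t)).det ≠ 0

/-- `s(M) = ⟨s_1, …, s_l⟩`: `M` is block lower-triangular with diagonal blocks of sizes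
`s_1, …, s_l`, none of which can be written as a block lower-triangular matrix with more than one
block. -/
def HasBlockStructure {m : ℕ} (M : Matrix (Fin m) (Fin m) (ZMod 2)) (s : List ℕ) : Prop :=
  IsBlockLowerTriangular s M ∧
  ∀ t : Fin s.length, ∀ s' : List ℕ,
    IsBlockLowerTriangular s' (diagBlock M (s.take t).sum (s.get t)) → s'.length ≤ 1

/-! ### Subcodes -/

/-- The vector `(b_1, …, b_S, c, …, c)` of length `m` (for `S ≤ m`). -/
def fillTop (m : ℕ) {S : ℕ} (c : ZMod 2) (b : Bits S) : Bits m :=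
  fun i => if h : (i : ℕ) < S then b ⟨i, h⟩ else c

/-- The index set `Ind_m(a_{S+1} = c, …, a_m = c)`. -/
def indTop (m S : ℕ) (c : ZMod 2) : Finset (Bits m) :=
  Finset.univ.filter fun a => ∀ i : Fin m, S ≤ (i : ℕ) → a i = c

/-- The information set `I(Ind_m(a_{S+1} = c, …, a_m = c)) ⊆ 𝔽₂^S` of the subcode on these
indices. -/
def subInfo {m : ℕ} (S : ℕ) (c : ZMod 2) (I : Finset (Bits m)) : Finset (Bits S) :=
  Finset.univ.filter fun b => fillTop m c b ∈ I

/-! ### Successive cancellation decoding -/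

/-- The LLR update `f`. -/
noncomputable def llrF (x y : ℝ) : ℝ :=
  Real.log ((Real.exp (x + y) + 1) / (Real.exp x + Real.exp y))

/-- The LLR update `g(u, x, y) = (-1)^u x + y`. -/
noncomputable def llrG (u : ZMod 2) (x y : ℝ) : ℝ := (-1) ^ u.val * x + y

/-- The SC decoder: it maps the LLRs `(L_{i,m})_i` to the hard decisions `(u_{i,m})_i`.  At stage
`m + 1` the index `z < 2^m` of the upper half is represented by `(b, 1)` and its partner `z + 2^m`
by `(b, 0)`.  The upper half is decoded from the LLRs `f(L_z, L_{z + 2^m})`, then the lower half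
from the LLRs `g(u_z, L_z, L_{z + 2^m})`, and the decisions of both are combined to
`(u_z + u_{z + 2^m}, u_{z + 2^m})`. -/
noncomputable def SC : (m : ℕ) → Finset (Bits m) → (Bits m → ℝ) → Bits m → ZMod 2
  | 0, I, L => fun a => if a ∈ I ∧ L a < 0 then 1 else 0
  | m + 1, I, L =>
    let upper : Bits m → ZMod 2 := SC m (subInfo m 1 I)
      (fun b => llrF (L (fillTop (m + 1) 1 b)) (L (fillTop (m + 1) 0 b)))
    let lower : Bits m → ZMod 2 := SC m (subInfo m 0 I)
      (fun b => llrG (upper b) (L (fillTop (m + 1) 1 b)) (L (fillTop (m + 1) 0 b)))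
    fun a =>
      let b : Bits m := fun i => a i.castSucc
      if a (Fin.last m) = 1 then upper b + lower b else lower b

/-- `π` commutes with `SC_I`. -/
def CommutesWithSC {m : ℕ} (I : Finset (Bits m)) (π : Equiv.Perm (Bits m)) : Prop :=
  ∀ y : Bits m → ℝ, SC m I (permute π y) = permute π (SC m I y)

/-- `π` commutes with `SC_I` at Lebesgue-almost every LLR vector.  The exceptional set leaves room
for the ties `L_{i,0} = 0`, at which the decoder breaks the symmetry by an arbitrary convention. -/
def AECommutesWithSC {m : ℕ} (I : Finset (Bits m)) (π : Equiv.Perm (Bits m)) : Prop :=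
  ∀ᵐ y : Bits m → ℝ ∂volume, SC m I (permute π y) = permute π (SC m I y)

/-! ### The decision algorithm -/

/-- The algorithm `DecAut`, taking the block sizes in the order `s_l, s_{l-1}, …, s_1`.  (The empty
list occurs only for `m = 0`.) -/
def decAutRev : List ℕ → (m : ℕ) → Finset (Bits m) → Bool
  | [], _, _ => true
  | [_], m, I => decide (Iᶜ ⊆ indTop m 0 1 ∨ I ⊆ indTop m 0 0)
  | k :: k' :: r, m, I =>
    let S := (k' :: r).sum
    if k = 1 then
      decAutRev (k' :: r) S (subInfo S 1 I) && decAutRev (k' :: r) S (subInfo S 0 I)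
    else if Iᶜ ⊆ indTop m S 1 then decAutRev (k' :: r) S (subInfo S 1 I)
    else if I ⊆ indTop m S 0 then decAutRev (k' :: r) S (subInfo S 0 I)
    else false

/-- `DecAut(⟨s_1, …, s_l⟩, I)` for an information set `I ⊆ 𝔽₂^m`, `m = s_1 + ⋯ + s_l`. -/
def DecAut {m : ℕ} (s : List ℕ) (I : Finset (Bits m)) : Bool := decAutRev s.reverse m I

/-!
The proof looks at the decoder near erasure patterns.  Take LLRs that are large and positive on a
set `R` of received positions and nearly `0` elsewhere.  In the update `f` two received values give
a received value, in the update `g` (while all decisions are `0`) one received value is enough, so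
which bit channels are erased is a combinatorial function of `R`: the set `unerased R` of channels
that are not erased arises from `R` by down-shifts in the directions `m, m - 1, …, 1`.  If
`I ⊆ unerased R`, the decoder outputs the zero word on the whole region
(`SC_eq_zero_of_subset_unerased`); otherwise it errs on a nonempty open subset of it
(`exists_isOpen_SC_ne_zero`).  Hence a permutation that commutes with the decoder on a dense set of
LLRs, in particular almost everywhere, belongs to the group `erasureSymm I` of permutations that
respect the condition `I ⊆ unerased R` (`mem_erasureSymm_of_dense`).

The rest is about this group.  Say that `π` has a cut at `p` if it preserves the vectors whose first
`p` coordinates vanish; for `φ(M)` the cuts are the partial sums of the block sizes.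

* Descent.  If `π` has a cut at `S`, it induces a permutation of `𝔽₂^S`, and this is a symmetry for
  both subcodes `I(A_1)` and `I(A_2)`: test `π` on received sets that are unions of fibers of
  `𝔽₂^m → 𝔽₂^S`, respectively on sets that miss at most one point of each fiber.
* The last block.  The group `erasureSymm I` contains all triangular permutations
  `a ↦ a + φ(a_1, …, a_{j-1}) e_j`, hence the transpositions of `a` and `a + e_m`.  If `π` has no
  cut strictly between `S` and `m`, conjugation produces from these all transpositions inside the
  fibers of `𝔽₂^m → 𝔽₂^S` (`swap_mem_erasureSymm`), so only the numbers of received positions in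
  these fibers matter.  Start with the received set `R = I`, for which `unerased I = I`.  As
  down-shifts preserve cardinalities, rearranging a fiber of `I` must not change the result, which
  forces each fiber of `I` to be full up to its largest point or empty up to its smallest point
  (`spliceBits_compl_mem`).  For blocks of size at least `2`, comparing neighbouring fibers and
  using that `I` is decreasing leaves only the two cases that the decision algorithm accepts
  (`compl_subset_or_subset_of_no_cut`).
-/

/-! ### Down-shifts of erasure patterns -/

/-- The unit vector `e_t`, with positions counted from `0`; it is the zero vector for `t ≥ m`. -/
def unitBits (m t : ℕ) : Bits m := fun i => if (i : ℕ) = t then 1 else 0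

/-- The down-shift of the set `R` in direction `t`: on each line `{a, a + e_t}` that meets `R` in
exactly one point, this point is moved to the one with `a_t = 0`.  For `t ≥ m` nothing happens. -/
def downShift {m : ℕ} (t : ℕ) (R : Finset (Bits m)) : Finset (Bits m) :=
  Finset.univ.filter fun a => (a ∈ R ∧ a + unitBits m t ∈ R) ∨
    ((∃ i : Fin m, (i : ℕ) = t ∧ a i = 0) ∧ (a ∈ R ∨ a + unitBits m t ∈ R))

/-- The down-shifts in the directions listed in `l`, the last entry of `l` being applied first. -/
def shiftAll {m : ℕ} (l : List ℕ) (R : Finset (Bits m)) : Finset (Bits m) :=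
  l.foldr downShift R

/-- The set of bit channels that are not erased if exactly the positions in `R` are received: the
down-shifts in all directions, in the order in which the decoder processes them (the last coordinate
first). -/
def unerased {m : ℕ} (R : Finset (Bits m)) : Finset (Bits m) := shiftAll (List.range m) R

lemma zmod_two_cases (z : ZMod 2) : z = 0 ∨ z = 1 := by
  revert z; decide

lemma zmod_two_ne_zero {z : ZMod 2} : z ≠ 0 ↔ z = 1 := by
  revert z; decide

lemma zmod_two_ne_one {z : ZMod 2} : z ≠ 1 ↔ z = 0 := by
  revert z; decide

lemma bits_add_self {m : ℕ} (a : Bits m) : a + a = 0 := by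
  funext i; exact CharTwo.add_self_eq_zero _

@[simp] lemma bits_add_add_cancel {m : ℕ} (a b : Bits m) : a + b + b = a := by
  rw [add_assoc, bits_add_self, add_zero]

@[simp] lemma unitBits_apply_self {m : ℕ} (i : Fin m) : unitBits m i i = 1 := by
  simp [unitBits]

lemma unitBits_apply_of_ne {m t : ℕ} {i : Fin m} (h : (i : ℕ) ≠ t) : unitBits m t i = 0 := by
  simp [unitBits, h]

lemma unitBits_of_le {m t : ℕ} (h : m ≤ t) : unitBits m t = 0 := by
  funext i; exact unitBits_apply_of_ne (by have := i.2; omega)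

lemma add_unitBits_apply_self {m : ℕ} (a : Bits m) (i : Fin m) :
    (a + unitBits m i) i = a i + 1 := by
  simp

lemma add_unitBits_apply_of_ne {m t : ℕ} (a : Bits m) {i : Fin m} (h : (i : ℕ) ≠ t) :
    (a + unitBits m t) i = a i := by
  simp [unitBits_apply_of_ne h]

lemma mem_downShift_of_one {m : ℕ} {R : Finset (Bits m)} {a : Bits m} {i : Fin m} (h : a i = 1) :
    a ∈ downShift i R ↔ a ∈ R ∧ a + unitBits m i ∈ R := by
  have : ¬ ∃ j : Fin m, (j : ℕ) = i ∧ a j = 0 := by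
    rintro ⟨j, hj, hj'⟩
    rw [Fin.ext hj, h] at hj'
    exact one_ne_zero hj'
  simp [downShift, this]

lemma mem_downShift_of_zero {m : ℕ} {R : Finset (Bits m)} {a : Bits m} {i : Fin m} (h : a i = 0) :
    a ∈ downShift i R ↔ a ∈ R ∨ a + unitBits m i ∈ R := by
  have : ∃ j : Fin m, (j : ℕ) = i ∧ a j = 0 := ⟨i, rfl, h⟩
  simp only [downShift, Finset.mem_filter, Finset.mem_univ, true_and, this]
  tauto

lemma downShift_of_le {m t : ℕ} (h : m ≤ t) (R : Finset (Bits m)) : downShift t R = R := by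
  ext a
  simp [downShift, unitBits_of_le h]

lemma shiftAll_append {m : ℕ} (l l' : List ℕ) (R : Finset (Bits m)) :
    shiftAll (l ++ l') R = shiftAll l (shiftAll l' R) := by
  simp [shiftAll]

lemma shiftAll_cons {m : ℕ} (t : ℕ) (l : List ℕ) (R : Finset (Bits m)) :
    shiftAll (t :: l) R = downShift t (shiftAll l R) := rfl

/-- The down-shifts in the coordinates from `S` on are applied before those below `S`. -/
lemma unerased_eq_shiftAll_shiftAll {m S : ℕ} (h : S ≤ m) (R : Finset (Bits m)) :
    unerased R = shiftAll (List.range S) (shiftAll (List.range' S (m - S)) R) := by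
  rw [unerased, ← shiftAll_append]
  congr 1
  rw [List.range_eq_range', List.range_eq_range']
  have := List.range'_append (s := 0) (m := S) (n := m - S) (step := 1)
  simp only [one_mul, zero_add] at this
  rw [this]
  congr 1
  omega

/-- A set is closed under lowering the coordinates in `l`. -/
def IsLowerIn {m : ℕ} (l : List ℕ) (R : Finset (Bits m)) : Prop :=
  ∀ i : Fin m, (i : ℕ) ∈ l → ∀ a ∈ R, a i = 1 → a + unitBits m i ∈ R

lemma downShift_eq_self {m t : ℕ} {R : Finset (Bits m)} (h : IsLowerIn [t] R) :
    downShift t R = R := by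
  rcases le_or_gt m t with ht | ht
  · exact downShift_of_le ht R
  ext a
  set i : Fin m := ⟨t, ht⟩
  change a ∈ downShift (i : ℕ) R ↔ _
  rcases zmod_two_cases (a i) with ha | ha
  · rw [mem_downShift_of_zero ha]
    refine ⟨?_, Or.inl⟩
    rintro (h1 | h1)
    · exact h1
    · simpa using h i (by simp [i]) _ h1 (by simp [ha])
  · rw [mem_downShift_of_one ha]
    exact ⟨fun h1 => h1.1, fun h1 => ⟨h1, h i (by simp [i]) _ h1 ha⟩⟩

lemma shiftAll_eq_self {m : ℕ} {l : List ℕ} {R : Finset (Bits m)} (h : IsLowerIn l R) :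
    shiftAll l R = R := by
  induction l with
  | nil => rfl
  | cons t l ih =>
    rw [shiftAll_cons, ih fun i hi => h i (List.mem_cons_of_mem _ hi)]
    exact downShift_eq_self fun i hi => h i (by simp_all)

lemma downShift_mono {m t : ℕ} {R R' : Finset (Bits m)} (h : R ⊆ R') :
    downShift t R ⊆ downShift t R' := by
  intro a
  simp only [downShift, Finset.mem_filter, Finset.mem_univ, true_and]
  have h1 := @h a
  have h2 := @h (a + unitBits m t)
  tauto

lemma shiftAll_mono {m : ℕ} (l : List ℕ) {R R' : Finset (Bits m)} (h : R ⊆ R') :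
    shiftAll l R ⊆ shiftAll l R' := by
  induction l with
  | nil => exact h
  | cons t l ih => exact downShift_mono ih

/-- Down-shifts in the directions `l` can be computed inside any union of `l`-cosets. -/
lemma mem_shiftAll_congr {m : ℕ} {l : List ℕ} {R R' : Finset (Bits m)} {φ : Bits m → Prop}
    (hφ : ∀ t ∈ l, ∀ a, φ (a + unitBits m t) ↔ φ a) (h : ∀ a, φ a → (a ∈ R ↔ a ∈ R'))
    {a : Bits m} (ha : φ a) : a ∈ shiftAll l R ↔ a ∈ shiftAll l R' := by
  induction l generalizing a with
  | nil => exact h a ha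
  | cons t l ih =>
    have ih := @ih fun s hs => hφ s (List.mem_cons_of_mem _ hs)
    have h1 := ih ha
    have h2 := ih ((hφ t (by simp) a).2 ha)
    simp only [shiftAll_cons, downShift, Finset.mem_filter, Finset.mem_univ, true_and, h1, h2]

lemma card_filter_downShift {m t : ℕ} (R : Finset (Bits m)) (φ : Bits m → Prop) [DecidablePred φ]
    (hφ : ∀ a, φ (a + unitBits m t) ↔ φ a) :
    ((downShift t R).filter φ).card = (R.filter φ).card := by
  rcases le_or_gt m t with ht | ht
  · rw [downShift_of_le ht R]
  set i : Fin m := ⟨t, ht⟩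
  have key : ∀ X : Finset (Bits m), (∑ a : Bits m,
      ((if a ∈ X ∧ φ a then 1 else 0) +
        (if a + unitBits m t ∈ X ∧ φ (a + unitBits m t) then 1 else 0)))
      = 2 * (X.filter φ).card := by
    intro X
    have h : (∑ a : Bits m, if a + unitBits m t ∈ X ∧ φ (a + unitBits m t) then 1 else 0) =
        ∑ a : Bits m, if a ∈ X ∧ φ a then 1 else 0 :=
      Equiv.sum_comp (Equiv.addRight (unitBits m t))
        (fun a => if a ∈ X ∧ φ a then (1 : ℕ) else 0)
    have hX : (Finset.univ.filter fun a => a ∈ X ∧ φ a) = X.filter φ := by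
      ext; simp
    rw [Finset.sum_add_distrib, h, ← two_mul, Finset.sum_boole, hX, Nat.cast_id]
  have : 2 * ((downShift t R).filter φ).card = 2 * (R.filter φ).card := by
    rw [← key, ← key]
    refine Finset.sum_congr rfl fun a _ => ?_
    by_cases hp : φ a
    · simp only [hφ, hp, and_true]
      change (if a ∈ downShift (i : ℕ) R then 1 else 0) +
        (if a + unitBits m i ∈ downShift (i : ℕ) R then 1 else 0) = _
      change _ = (if a ∈ R then 1 else 0) + (if a + unitBits m i ∈ R then 1 else 0)
      rcases zmod_two_cases (a i) with ha | ha
      · have hb : (a + unitBits m i) i = 1 := by simp [ha]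
        simp only [mem_downShift_of_zero ha, mem_downShift_of_one hb, bits_add_add_cancel]
        by_cases h1 : a ∈ R <;> by_cases h2 : a + unitBits m i ∈ R <;> simp [h1, h2]
      · have hb : (a + unitBits m i) i = 0 := by simp [ha, CharTwo.add_self_eq_zero]
        simp only [mem_downShift_of_one ha, mem_downShift_of_zero hb, bits_add_add_cancel]
        by_cases h1 : a ∈ R <;> by_cases h2 : a + unitBits m i ∈ R <;> simp [h1, h2]
    · simp [hφ, hp]
  omega

/-- Down-shifts in the directions `l` preserve the number of points in every union of
`l`-cosets. -/
lemma card_filter_shiftAll {m : ℕ} (l : List ℕ) (R : Finset (Bits m)) (φ : Bits m → Prop)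
    [DecidablePred φ] (hφ : ∀ t ∈ l, ∀ a, φ (a + unitBits m t) ↔ φ a) :
    ((shiftAll l R).filter φ).card = (R.filter φ).card := by
  induction l with
  | nil => rfl
  | cons t l ih =>
    rw [shiftAll_cons, card_filter_downShift _ _ (hφ t (by simp)),
      ih fun s hs => hφ s (List.mem_cons_of_mem _ hs)]

lemma card_unerased {m : ℕ} (R : Finset (Bits m)) : (unerased R).card = R.card := by
  simpa [unerased] using card_filter_shiftAll (List.range m) R (fun _ => True) (by simp)

/-! ### Restriction to the first coordinates -/

lemma fillTop_apply_of_lt {m S : ℕ} (c : ZMod 2) (b : Bits S) {i : Fin m} (h : (i : ℕ) < S) :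
    fillTop m c b i = b ⟨i, h⟩ := by
  simp [fillTop, h]

lemma fillTop_apply_of_le {m S : ℕ} (c : ZMod 2) (b : Bits S) {i : Fin m} (h : S ≤ (i : ℕ)) :
    fillTop m c b i = c := by
  simp [fillTop, not_lt.2 h]

/-- The vector `(a_1, …, a_S)` of the first `S` coordinates. -/
def lowBits {m S : ℕ} (h : S ≤ m) (a : Bits m) : Bits S := fun i => a (Fin.castLE h i)

@[simp] lemma lowBits_fillTop {m S : ℕ} (h : S ≤ m) (c : ZMod 2) (b : Bits S) :
    lowBits h (fillTop m c b) = b := by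
  funext i
  simp [lowBits, fillTop]

lemma lowBits_add {m S : ℕ} (h : S ≤ m) (a b : Bits m) :
    lowBits h (a + b) = lowBits h a + lowBits h b := rfl

lemma lowBits_unitBits {m S t : ℕ} (h : S ≤ m) : lowBits h (unitBits m t) = unitBits S t := rfl

lemma lowBits_add_unitBits_of_le {m S t : ℕ} (h : S ≤ m) (ht : S ≤ t) (a : Bits m) :
    lowBits h (a + unitBits m t) = lowBits h a := by
  rw [lowBits_add, lowBits_unitBits, unitBits_of_le ht, add_zero]

lemma fillTop_add_unitBits {m S t : ℕ} (ht : t < S) (c : ZMod 2) (b : Bits S) :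
    fillTop m c (b + unitBits S t) = fillTop m c b + unitBits m t := by
  funext i
  rcases lt_or_ge (i : ℕ) S with hi | hi
  · simp [fillTop, hi, unitBits]
  · rw [Pi.add_apply, fillTop_apply_of_le _ _ hi, fillTop_apply_of_le _ _ hi,
      unitBits_apply_of_ne (by omega), add_zero]

lemma subInfo_downShift {m S t : ℕ} (h : S ≤ m) (ht : t < S) (c : ZMod 2) (R : Finset (Bits m)) :
    subInfo S c (downShift t R) = downShift t (subInfo S c R) := by
  ext b
  have : (∃ i : Fin m, (i : ℕ) = t ∧ fillTop m c b i = 0) ↔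
      ∃ i : Fin S, (i : ℕ) = t ∧ b i = 0 := by
    constructor
    · rintro ⟨i, hi, hb⟩
      exact ⟨⟨i, by omega⟩, hi, by rwa [fillTop_apply_of_lt _ _ (by omega)] at hb⟩
    · rintro ⟨i, hi, hb⟩
      exact ⟨Fin.castLE h i, hi, by rw [fillTop_apply_of_lt _ _ (by simp)]; exact hb⟩
  simp only [subInfo, downShift, Finset.mem_filter, Finset.mem_univ, true_and, this,
    fillTop_add_unitBits ht]

lemma subInfo_shiftAll {m S : ℕ} (h : S ≤ m) {l : List ℕ} (hl : ∀ t ∈ l, t < S) (c : ZMod 2)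
    (R : Finset (Bits m)) : subInfo S c (shiftAll l R) = shiftAll l (subInfo S c R) := by
  induction l with
  | nil => rfl
  | cons t l ih =>
    rw [shiftAll_cons, subInfo_downShift h (hl t (by simp)),
      ih fun s hs => hl s (List.mem_cons_of_mem _ hs), shiftAll_cons]

/-- Down-shifts below `S` of a cylinder over `A ⊆ 𝔽₂^S`, to which a set depending only on the
other coordinates is added. -/
lemma shiftAll_cylinder {m S : ℕ} (h : S ≤ m) {l : List ℕ} (hl : ∀ t ∈ l, t < S)
    (A : Finset (Bits S)) (ψ : Bits m → Prop) [DecidablePred ψ]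
    (hψ : ∀ t ∈ l, ∀ a, ψ (a + unitBits m t) ↔ ψ a) :
    shiftAll l (Finset.univ.filter fun a : Bits m => lowBits h a ∈ A ∨ ψ a) =
      Finset.univ.filter fun a : Bits m => lowBits h a ∈ shiftAll l A ∨ ψ a := by
  induction l with
  | nil => rfl
  | cons t l ih =>
    rw [shiftAll_cons, ih (fun s hs => hl s (List.mem_cons_of_mem _ hs))
      fun s hs => hψ s (List.mem_cons_of_mem _ hs), shiftAll_cons]
    ext a
    have h1 : (∃ i : Fin m, (i : ℕ) = t ∧ a i = 0) ↔
        ∃ i : Fin S, (i : ℕ) = t ∧ lowBits h a i = 0 := by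
      constructor
      · rintro ⟨i, hi, hb⟩
        exact ⟨⟨i, by have := hl t (by simp); omega⟩, hi, hb⟩
      · rintro ⟨i, hi, hb⟩
        exact ⟨Fin.castLE h i, hi, hb⟩
    simp only [downShift, Finset.mem_filter, Finset.mem_univ, true_and, lowBits_add,
      lowBits_unitBits, hψ t (by simp), h1]
    by_cases hp : ψ a <;> simp [hp]

/-! ### The decoder on erasure patterns -/

lemma subInfo_mem {m S : ℕ} {c : ZMod 2} {I : Finset (Bits m)} {b : Bits S} :
    b ∈ subInfo S c I ↔ fillTop m c b ∈ I := by
  simp [subInfo]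

lemma fillTop_succ_last {m : ℕ} (c : ZMod 2) (b : Bits m) :
    fillTop (m + 1) c b (Fin.last m) = c := by
  simp [fillTop]

lemma fillTop_succ_castSucc {m : ℕ} (c : ZMod 2) (b : Bits m) :
    (fun i : Fin m => fillTop (m + 1) c b i.castSucc) = b := by
  funext i
  simp [fillTop]

lemma fillTop_succ_eta {m : ℕ} (a : Bits (m + 1)) :
    fillTop (m + 1) (a (Fin.last m)) (fun i : Fin m => a i.castSucc) = a := by
  funext i
  refine Fin.lastCases ?_ (fun j => ?_) i <;> simp [fillTop]

lemma fillTop_succ_add_unitBits {m : ℕ} (c : ZMod 2) (b : Bits m) :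
    fillTop (m + 1) c b + unitBits (m + 1) m = fillTop (m + 1) (c + 1) b := by
  funext i
  refine Fin.lastCases ?_ (fun j => ?_) i
  · simp [fillTop, unitBits]
  · simp [fillTop, unitBits, j.2.ne]

lemma mem_subInfo_one_downShift {m : ℕ} {R : Finset (Bits (m + 1))} {b : Bits m} :
    b ∈ subInfo m 1 (downShift m R) ↔ fillTop (m + 1) 1 b ∈ R ∧ fillTop (m + 1) 0 b ∈ R := by
  have h := mem_downShift_of_one (R := R) (fillTop_succ_last 1 b)
  rw [Fin.val_last, fillTop_succ_add_unitBits, CharTwo.add_self_eq_zero] at h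
  rw [subInfo_mem, h]

lemma mem_subInfo_zero_downShift {m : ℕ} {R : Finset (Bits (m + 1))} {b : Bits m} :
    b ∈ subInfo m 0 (downShift m R) ↔ fillTop (m + 1) 1 b ∈ R ∨ fillTop (m + 1) 0 b ∈ R := by
  have h := mem_downShift_of_zero (R := R) (fillTop_succ_last 0 b)
  rw [Fin.val_last, fillTop_succ_add_unitBits, zero_add] at h
  rw [subInfo_mem, h, or_comm]

/-- The recursive structure of the decoding condition: the upper half is decoded from the lines that
are received completely, the lower half from the lines that are received at least once. -/
lemma subset_unerased_succ {m : ℕ} (I R : Finset (Bits (m + 1))) :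
    I ⊆ unerased R ↔ subInfo m 1 I ⊆ unerased (subInfo m 1 (downShift m R)) ∧
      subInfo m 0 I ⊆ unerased (subInfo m 0 (downShift m R)) := by
  have h : unerased R = shiftAll (List.range m) (downShift m R) := by
    rw [unerased, List.range_succ, shiftAll_append]; rfl
  have h' : ∀ c, unerased (subInfo m c (downShift m R)) = subInfo m c (unerased R) := by
    intro c
    rw [h, subInfo_shiftAll (Nat.le_succ m) (by simp), unerased]
  rw [h', h']
  refine ⟨fun hI => ⟨fun b hb => ?_, fun b hb => ?_⟩, fun hI a ha => ?_⟩
  · exact subInfo_mem.2 (hI (subInfo_mem.1 hb))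
  · exact subInfo_mem.2 (hI (subInfo_mem.1 hb))
  · rw [← fillTop_succ_eta a] at ha ⊢
    rcases zmod_two_cases (a (Fin.last m)) with h0 | h0
    · rw [h0] at ha ⊢
      exact subInfo_mem.1 (hI.2 (subInfo_mem.2 ha))
    · rw [h0] at ha ⊢
      exact subInfo_mem.1 (hI.1 (subInfo_mem.2 ha))

/-- The LLRs from which the upper half is decoded. -/
noncomputable def upperLLR {m : ℕ} (y : Bits (m + 1) → ℝ) : Bits m → ℝ :=
  fun b => llrF (y (fillTop (m + 1) 1 b)) (y (fillTop (m + 1) 0 b))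

/-- The LLRs from which the lower half is decoded if all decisions in the upper half are `0`. -/
def sumLLR {m : ℕ} (y : Bits (m + 1) → ℝ) : Bits m → ℝ :=
  fun b => y (fillTop (m + 1) 1 b) + y (fillTop (m + 1) 0 b)

/-- Whether the decoder outputs the zero word can be decided with the sums `sumLLR`, although for
other words it uses different LLRs in the lower half. -/
lemma SC_succ_eq_zero_iff {m : ℕ} (I : Finset (Bits (m + 1))) (y : Bits (m + 1) → ℝ) :
    SC (m + 1) I y = 0 ↔
      SC m (subInfo m 1 I) (upperLLR y) = 0 ∧ SC m (subInfo m 0 I) (sumLLR y) = 0 := by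
  have key : ∀ u l : Bits m → ZMod 2, ((fun a : Bits (m + 1) =>
      if a (Fin.last m) = 1 then (u + l) (fun i => a i.castSucc)
      else l (fun i => a i.castSucc)) = 0) ↔ u = 0 ∧ l = 0 := by
    intro u l
    constructor
    · intro h
      have h0 : l = 0 := by
        funext b
        have := congrFun h (fillTop (m + 1) 0 b)
        simpa [fillTop_succ_last, fillTop_succ_castSucc] using this
      refine ⟨?_, h0⟩
      funext b
      have := congrFun h (fillTop (m + 1) 1 b)
      simpa [fillTop_succ_last, fillTop_succ_castSucc, h0] using this
    · rintro ⟨rfl, rfl⟩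
      funext a
      simp
  have hG : ∀ u : Bits m → ZMod 2, u = 0 →
      (fun b => llrG (u b) (y (fillTop (m + 1) 1 b)) (y (fillTop (m + 1) 0 b))) = sumLLR y := by
    rintro u rfl
    funext b
    simp [llrG, sumLLR]
  refine (key (SC m (subInfo m 1 I) (upperLLR y)) (SC m (subInfo m 0 I) fun b =>
    llrG (SC m (subInfo m 1 I) (upperLLR y) b) (y (fillTop (m + 1) 1 b))
      (y (fillTop (m + 1) 0 b)))).trans ?_
  refine and_congr_right fun h => ?_
  rw [hG _ h]

lemma llrF_arg_pos (x y : ℝ) : 0 < (Real.exp (x + y) + 1) / (Real.exp x + Real.exp y) := by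
  positivity

lemma sub_one_lt_llrF {K x y : ℝ} (hx : K < x) (hy : K < y) : K - 1 < llrF x y := by
  rw [llrF, Real.lt_log_iff_exp_lt (llrF_arg_pos x y), lt_div_iff₀ (by positivity)]
  have hhalf : Real.exp (-1) ≤ 1 / 2 := by
    rw [Real.exp_neg, inv_le_comm₀ (Real.exp_pos _) (by norm_num)]
    have := Real.add_one_le_exp (1 : ℝ)
    linarith
  have key : ∀ z, K + z ≤ x + y →
      Real.exp (K - 1) * Real.exp z ≤ Real.exp (x + y) * (1 / 2) := by
    intro z hz
    calc Real.exp (K - 1) * Real.exp z ≤ Real.exp (x + y) * Real.exp (-1) := by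
          rw [← Real.exp_add, ← Real.exp_add]
          exact Real.exp_le_exp.2 (by linarith)
      _ ≤ _ := by gcongr
  linarith [key x (by linarith), key y (by linarith)]

lemma llrF_comm (x y : ℝ) : llrF x y = llrF y x := by
  rw [llrF, llrF, add_comm x, add_comm (Real.exp x)]

lemma llrF_neg_left (x y : ℝ) : llrF (-x) y = -llrF x y := by
  rw [llrF, llrF, ← Real.log_inv, inv_div]
  congr 1
  rw [div_eq_div_iff (by positivity) (by positivity), Real.exp_add, Real.exp_add, Real.exp_neg]
  field_simp
  ring

lemma llrF_lt_left {x y : ℝ} (hx : 0 < x) : llrF x y < x := by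
  rw [llrF, Real.log_lt_iff_lt_exp (llrF_arg_pos x y), div_lt_iff₀ (by positivity), mul_add,
    ← Real.exp_add, ← Real.exp_add]
  have : 1 < Real.exp (x + x) := Real.one_lt_exp_iff.2 (by linarith)
  linarith

lemma llrF_pos {x y : ℝ} (hx : 0 < x) (hy : 0 < y) : 0 < llrF x y := by
  rw [llrF]
  refine Real.log_pos ?_
  rw [one_lt_div (by positivity), Real.exp_add]
  nlinarith [Real.one_lt_exp_iff.2 hx, Real.one_lt_exp_iff.2 hy]

lemma llrF_zero_left (y : ℝ) : llrF 0 y = 0 := by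
  rw [llrF, zero_add, Real.exp_zero, add_comm, div_self (by positivity), Real.log_one]

lemma abs_llrF_lt {ε x : ℝ} (y : ℝ) (hx : |x| < ε) : |llrF x y| < ε := by
  rw [abs_lt] at hx
  rcases lt_trichotomy x 0 with h | h | h
  · have h1 := llrF_lt_left (x := -x) (y := y) (by linarith)
    have h2 := llrF_lt_left (x := -x) (y := -y) (by linarith)
    rw [llrF_comm _ (-y), llrF_neg_left, llrF_comm, llrF_neg_left] at h2
    rw [llrF_neg_left] at h1
    rw [abs_lt]
    constructor <;> linarith
  · subst h
    rw [llrF_zero_left, abs_zero]; linarith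
  · have h1 := llrF_lt_left (y := y) h
    have h2 := llrF_lt_left (y := -y) h
    rw [llrF_comm _ (-y), llrF_neg_left, llrF_comm] at h2
    rw [abs_lt]
    constructor <;> linarith

lemma continuous_llrF : Continuous fun p : ℝ × ℝ => llrF p.1 p.2 := by
  unfold llrF
  refine Continuous.log ?_ fun p => (llrF_arg_pos p.1 p.2).ne'
  exact Continuous.div (by fun_prop) (by fun_prop) fun p => by positivity

lemma continuous_upperLLR {m : ℕ} : Continuous (upperLLR (m := m)) := by
  refine continuous_pi fun b => ?_
  have h : Continuous fun y : Bits (m + 1) → ℝ =>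
      (y (fillTop (m + 1) 1 b), y (fillTop (m + 1) 0 b)) := by fun_prop
  exact continuous_llrF.comp h

lemma continuous_sumLLR {m : ℕ} : Continuous (sumLLR (m := m)) :=
  continuous_pi fun _ => (continuous_apply _).add (continuous_apply _)

/-- All sufficiently small LLRs are values of `llrF` with a given second argument and a small first
argument. -/
lemma exists_llrF_eq_of_small {δ c : ℝ} (hδ : 0 < δ) (hc : 0 < c) :
    ∃ η > 0, ∀ z : ℝ, |z| < η → ∃ x, |x| ≤ δ ∧ llrF x c = z := by
  refine ⟨llrF δ c, llrF_pos hδ hc, fun z hz => ?_⟩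
  have hcont : ContinuousOn (fun x => llrF x c) (Set.Icc (-δ) δ) :=
    (continuous_llrF.comp (continuous_id.prodMk continuous_const)).continuousOn
  rw [abs_lt] at hz
  obtain ⟨x, hx, hxz⟩ := intermediate_value_Icc (by linarith) hcont
    (show z ∈ Set.Icc (llrF (-δ) c) (llrF δ c) by
      rw [llrF_neg_left]; exact ⟨hz.1.le, hz.2.le⟩)
  exact ⟨x, abs_le.2 hx, hxz⟩

lemma exists_llrF_diag_eq {z : ℝ} (hz : 0 < z) : ∃ x, z ≤ x ∧ llrF x x = z := by
  have hcont : ContinuousOn (fun x => llrF x x) (Set.Icc z (z + 2)) :=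
    (continuous_llrF.comp (continuous_id.prodMk continuous_id)).continuousOn
  obtain ⟨x, hx, hxz⟩ := intermediate_value_Icc (by linarith) hcont
    (show z ∈ Set.Icc (llrF z z) (llrF (z + 2) (z + 2)) from
      ⟨(llrF_lt_left hz).le, by
        have := sub_one_lt_llrF (K := z + 1) (x := z + 2) (y := z + 2) (by linarith) (by linarith)
        linarith⟩)
  exact ⟨x, hx.1, hxz⟩

/-- The LLR vectors in which the positions of `R` are received as reliable zeros (LLR above `K`),
while the other positions are nearly erased (LLR below `ε` in absolute value). -/
def receivedRegion {m : ℕ} (R : Finset (Bits m)) (K ε : ℝ) : Set (Bits m → ℝ) :=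
  {y | ∀ a, (a ∈ R → K < y a) ∧ (a ∉ R → |y a| < ε)}

lemma isOpen_receivedRegion {m : ℕ} (R : Finset (Bits m)) (K ε : ℝ) :
    IsOpen (receivedRegion R K ε) := by
  simp only [receivedRegion, Set.ofPred_forall, Set.ofPred_and]
  refine isOpen_iInter_of_finite fun a => IsOpen.inter ?_ ?_
  · by_cases h : a ∈ R
    · simpa [h] using isOpen_lt continuous_const (continuous_apply a)
    · simp [h]
  · by_cases h : a ∈ R
    · simp [h]
    · simpa [h] using isOpen_lt (continuous_apply a).abs continuous_const

/-- If `R` leaves no information bit erased, the decoder outputs the zero word near the erasure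
pattern `R`. -/
lemma SC_eq_zero_of_subset_unerased (m : ℕ) (I R : Finset (Bits m)) (K ε : ℝ) (hε : 0 < ε)
    (hK : 3 ^ m * ε + m < K) (hI : I ⊆ unerased R) (y : Bits m → ℝ)
    (hy : y ∈ receivedRegion R K ε) : SC m I y = 0 := by
  induction m generalizing K ε with
  | zero =>
    funext a
    have : ¬ (a ∈ I ∧ y a < 0) := by
      rintro ⟨ha, hlt⟩
      have h1 : K < y a := (hy a).1 (hI ha)
      norm_num at hK
      linarith
    change (if a ∈ I ∧ y a < 0 then 1 else 0) = (0 : ZMod 2)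
    rw [if_neg this]
  | succ m ih =>
    rw [subset_unerased_succ] at hI
    rw [SC_succ_eq_zero_iff]
    have h3 : ε ≤ 3 ^ m * ε := le_mul_of_one_le_left hε.le (one_le_pow₀ (by norm_num))
    push_cast at hK
    rw [pow_succ] at hK
    refine ⟨ih _ _ (K - 1) ε hε (by nlinarith) hI.1 _ fun b => ⟨fun hb => ?_, fun hb => ?_⟩,
      ih _ _ (K - ε) (2 * ε) (by positivity) (by nlinarith) hI.2 _
        fun b => ⟨fun hb => ?_, fun hb => ?_⟩⟩
    · rw [mem_subInfo_one_downShift] at hb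
      exact sub_one_lt_llrF ((hy _).1 hb.1) ((hy _).1 hb.2)
    · rw [mem_subInfo_one_downShift, not_and_or] at hb
      rcases hb with hb | hb
      · exact abs_llrF_lt _ ((hy _).2 hb)
      · rw [upperLLR, llrF_comm]
        exact abs_llrF_lt _ ((hy _).2 hb)
    · have hlow : ∀ a, -ε < y a := by
        intro a
        by_cases ha : a ∈ R
        · have := (hy a).1 ha
          have : (0 : ℝ) ≤ m := Nat.cast_nonneg m
          nlinarith
        · exact (abs_lt.1 ((hy a).2 ha)).1
      have h0 := hlow (fillTop (m + 1) 0 b)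
      have h1 := hlow (fillTop (m + 1) 1 b)
      rw [sumLLR]
      rcases mem_subInfo_zero_downShift.1 hb with hb | hb
      · have := (hy _).1 hb
        linarith
      · have := (hy _).1 hb
        linarith
    · rw [mem_subInfo_zero_downShift, not_or] at hb
      have h1 := abs_lt.1 ((hy _).2 hb.1)
      have h2 := abs_lt.1 ((hy _).2 hb.2)
      rw [sumLLR, abs_lt]
      constructor <;> linarith

/-- A vector of LLRs at stage `m + 1`, given by its two halves. -/
def glueLLR {m : ℕ} (p : Bits m → ℝ × ℝ) : Bits (m + 1) → ℝ :=
  fun a => if a (Fin.last m) = 1 then (p fun i => a i.castSucc).1 else (p fun i => a i.castSucc).2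

lemma glueLLR_one {m : ℕ} (p : Bits m → ℝ × ℝ) (b : Bits m) :
    glueLLR p (fillTop (m + 1) 1 b) = (p b).1 := by
  simp [glueLLR, fillTop_succ_last, fillTop_succ_castSucc]

lemma glueLLR_zero {m : ℕ} (p : Bits m → ℝ × ℝ) (b : Bits m) :
    glueLLR p (fillTop (m + 1) 0 b) = (p b).2 := by
  simp [glueLLR, fillTop_succ_last, fillTop_succ_castSucc]

lemma glueLLR_mem_receivedRegion {m : ℕ} {R : Finset (Bits (m + 1))} {K ε : ℝ}
    {p : Bits m → ℝ × ℝ}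
    (h : ∀ b, ((fillTop (m + 1) 1 b ∈ R → K < (p b).1) ∧
        (fillTop (m + 1) 1 b ∉ R → |(p b).1| < ε)) ∧
      ((fillTop (m + 1) 0 b ∈ R → K < (p b).2) ∧ (fillTop (m + 1) 0 b ∉ R → |(p b).2| < ε))) :
    glueLLR p ∈ receivedRegion R K ε := by
  intro a
  rw [← fillTop_succ_eta a]
  rcases zmod_two_cases (a (Fin.last m)) with h0 | h0
  · rw [h0, glueLLR_zero]; exact (h _).2
  · rw [h0, glueLLR_one]; exact (h _).1

/-- If `R` leaves an information bit erased, then arbitrarily close to the erasure pattern `R` there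
is a nonempty open set of LLR vectors on which the decoder errs. -/
lemma exists_isOpen_SC_ne_zero (m : ℕ) (I R : Finset (Bits m)) (K ε : ℝ) (hε : 0 < ε)
    (hK : 3 ^ m * ε + m < K) (hI : ¬ I ⊆ unerased R) :
    ∃ V : Set (Bits m → ℝ), IsOpen V ∧ V.Nonempty ∧ V ⊆ receivedRegion R K ε ∧
      ∀ y ∈ V, SC m I y ≠ 0 := by
  induction m generalizing K ε with
  | zero =>
    obtain ⟨a, ha, haR⟩ := Finset.not_subset.1 hI
    refine ⟨receivedRegion R K ε ∩ {y | y a < 0}, (isOpen_receivedRegion R K ε).inter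
      (isOpen_lt (continuous_apply a) continuous_const), ⟨fun _ => -(ε / 2), fun b => ?_, ?_⟩,
      Set.inter_subset_left, fun y hy h => ?_⟩
    · rw [Subsingleton.elim b a]
      refine ⟨fun h => absurd h haR, fun _ => ?_⟩
      rw [abs_neg, abs_of_pos (by positivity)]
      linarith
    · change -(ε / 2) < 0
      linarith
    · have h1 := congrFun h a
      change (if a ∈ I ∧ y a < 0 then 1 else 0) = (0 : ZMod 2) at h1
      rw [if_pos ⟨ha, hy.2⟩] at h1
      exact one_ne_zero h1
  | succ m ih =>
    have h3 : ε ≤ 3 ^ m * ε := le_mul_of_one_le_left hε.le (one_le_pow₀ (by norm_num))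
    have hm : (0 : ℝ) ≤ m := Nat.cast_nonneg m
    have hK' := hK
    push_cast at hK'
    rw [pow_succ] at hK'
    have hK0 : 0 < K := by nlinarith
    by_cases h1 : subInfo m 1 I ⊆ unerased (subInfo m 1 (downShift m R))
    -- The lower half fails: lift a failing vector of sums to both halves.
    · have h0 : ¬ subInfo m 0 I ⊆ unerased (subInfo m 0 (downShift m R)) := fun h0 =>
        hI ((subset_unerased_succ I R).2 ⟨h1, h0⟩)
      obtain ⟨V, hVo, ⟨z, hz⟩, hVR, hV⟩ := ih _ _ (2 * K) ε hε (by nlinarith) h0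
      refine ⟨receivedRegion R K ε ∩ sumLLR ⁻¹' V, (isOpen_receivedRegion R K ε).inter
        (hVo.preimage continuous_sumLLR), ?_, Set.inter_subset_left, fun y hy h => ?_⟩
      swap
      · exact hV _ hy.2 ((SC_succ_eq_zero_iff I y).1 h).2
      have hex : ∀ b, ∃ p : ℝ × ℝ, (((fillTop (m + 1) 1 b ∈ R → K < p.1) ∧
          (fillTop (m + 1) 1 b ∉ R → |p.1| < ε)) ∧
          ((fillTop (m + 1) 0 b ∈ R → K < p.2) ∧ (fillTop (m + 1) 0 b ∉ R → |p.2| < ε))) ∧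
          p.1 + p.2 = z b := by
        intro b
        have hzb := hVR hz b
        rw [mem_subInfo_zero_downShift] at hzb
        by_cases hb1 : fillTop (m + 1) 1 b ∈ R <;> by_cases hb0 : fillTop (m + 1) 0 b ∈ R
        · have := hzb.1 (Or.inl hb1)
          refine ⟨(z b / 2, z b / 2), ?_, by ring⟩
          simp only [hb1, hb0, forall_const, not_true_eq_false, IsEmpty.forall_iff, and_true]
          constructor <;> linarith
        · have := hzb.1 (Or.inl hb1)
          refine ⟨(z b, 0), ?_, by ring⟩
          simp only [hb1, hb0, forall_const, not_true_eq_false, IsEmpty.forall_iff, and_true,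
            true_and, not_false_eq_true, abs_zero]
          constructor <;> linarith
        · have := hzb.1 (Or.inr hb0)
          refine ⟨(0, z b), ?_, by ring⟩
          simp only [hb1, hb0, forall_const, not_true_eq_false, IsEmpty.forall_iff, and_true,
            true_and, not_false_eq_true, abs_zero]
          constructor <;> linarith
        · have := abs_lt.1 (hzb.2 (by tauto))
          refine ⟨(z b / 2, z b / 2), ?_, by ring⟩
          simp only [hb1, hb0, forall_const, IsEmpty.forall_iff, true_and, not_false_eq_true,
            abs_lt]
          refine ⟨⟨?_, ?_⟩, ?_, ?_⟩ <;> linarith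
      choose p hp hpz using hex
      refine ⟨glueLLR p, glueLLR_mem_receivedRegion hp, ?_⟩
      have : sumLLR (glueLLR p) = z := by
        funext b
        rw [sumLLR, glueLLR_one, glueLLR_zero, hpz]
      rwa [Set.mem_preimage, this]
    -- The upper half already fails: lift a failing vector of upper LLRs to both halves.
    · obtain ⟨η₁, hη₁, H₁⟩ := exists_llrF_eq_of_small (half_pos hε) (half_pos hε)
      obtain ⟨η₂, hη₂, H₂⟩ := exists_llrF_eq_of_small (half_pos hε) (show 0 < K + 1 by linarith)
      have hη : 0 < min ε (min η₁ η₂) := lt_min hε (lt_min hη₁ hη₂)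
      obtain ⟨V, hVo, ⟨z, hz⟩, hVR, hV⟩ := ih _ _ K (min ε (min η₁ η₂)) hη (by
        have : 3 ^ m * min ε (min η₁ η₂) ≤ 3 ^ m * ε := by
          gcongr
          exact min_le_left _ _
        nlinarith) h1
      refine ⟨receivedRegion R K ε ∩ upperLLR ⁻¹' V, (isOpen_receivedRegion R K ε).inter
        (hVo.preimage continuous_upperLLR), ?_, Set.inter_subset_left, fun y hy h => ?_⟩
      swap
      · exact hV _ hy.2 ((SC_succ_eq_zero_iff I y).1 h).1
      have hex : ∀ b, ∃ p : ℝ × ℝ, (((fillTop (m + 1) 1 b ∈ R → K < p.1) ∧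
          (fillTop (m + 1) 1 b ∉ R → |p.1| < ε)) ∧
          ((fillTop (m + 1) 0 b ∈ R → K < p.2) ∧ (fillTop (m + 1) 0 b ∉ R → |p.2| < ε))) ∧
          llrF p.1 p.2 = z b := by
        intro b
        have hzb := hVR hz b
        rw [mem_subInfo_one_downShift] at hzb
        by_cases hb1 : fillTop (m + 1) 1 b ∈ R <;> by_cases hb0 : fillTop (m + 1) 0 b ∈ R
        · have hKz := hzb.1 ⟨hb1, hb0⟩
          obtain ⟨x, hx, hxz⟩ := exists_llrF_diag_eq (hK0.trans hKz)
          refine ⟨(x, x), ?_, hxz⟩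
          simp only [hb1, hb0, forall_const, not_true_eq_false, IsEmpty.forall_iff, and_true]
          constructor <;> linarith
        · have hlt := hzb.2 (by tauto)
          obtain ⟨x, hx, hxz⟩ := H₂ _ (hlt.trans_le ((min_le_right _ _).trans (min_le_right _ _)))
          refine ⟨(K + 1, x), ?_, by rw [llrF_comm]; exact hxz⟩
          simp only [hb1, hb0, forall_const, not_true_eq_false, IsEmpty.forall_iff, and_true,
            true_and, not_false_eq_true]
          constructor <;> linarith
        · have hlt := hzb.2 (by tauto)
          obtain ⟨x, hx, hxz⟩ := H₂ _ (hlt.trans_le ((min_le_right _ _).trans (min_le_right _ _)))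
          refine ⟨(x, K + 1), ?_, hxz⟩
          simp only [hb1, hb0, forall_const, not_true_eq_false, IsEmpty.forall_iff, and_true,
            true_and, not_false_eq_true]
          constructor <;> linarith
        · have hlt := hzb.2 (by tauto)
          obtain ⟨x, hx, hxz⟩ := H₁ _ (hlt.trans_le ((min_le_right _ _).trans (min_le_left _ _)))
          refine ⟨(x, ε / 2), ?_, hxz⟩
          simp only [hb1, hb0, forall_const, IsEmpty.forall_iff, true_and, not_false_eq_true,
            abs_of_pos (half_pos hε)]
          constructor <;> linarith
      choose p hp hpz using hex
      refine ⟨glueLLR p, glueLLR_mem_receivedRegion hp, ?_⟩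
      have : upperLLR (glueLLR p) = z := by
        funext b
        rw [upperLLR, glueLLR_one, glueLLR_zero, hpz]
      rwa [Set.mem_preimage, this]

/-! ### Permutations of erasure patterns -/

/-- The preimage of `R` under the permutation `g`: the erasure pattern seen by the decoder after
permuting by `g` a word received on `R`. -/
def pullback {m : ℕ} (g : Equiv.Perm (Bits m)) (R : Finset (Bits m)) : Finset (Bits m) :=
  Finset.univ.filter fun a => g a ∈ R

@[simp] lemma mem_pullback {m : ℕ} {g : Equiv.Perm (Bits m)} {R : Finset (Bits m)} {a : Bits m} :
    a ∈ pullback g R ↔ g a ∈ R := by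
  simp [pullback]

lemma pullback_mul {m : ℕ} (g h : Equiv.Perm (Bits m)) (R : Finset (Bits m)) :
    pullback (g * h) R = pullback h (pullback g R) := by
  ext; simp

lemma pullback_one {m : ℕ} (R : Finset (Bits m)) : pullback 1 R = R := by
  ext; simp

/-- The group of permutations that respect decodability of erasure patterns by the successive
cancellation decoder. -/
def erasureSymm {m : ℕ} (I : Finset (Bits m)) : Subgroup (Equiv.Perm (Bits m)) where
  carrier := {g | ∀ R, I ⊆ unerased (pullback g R) ↔ I ⊆ unerased R}
  one_mem' R := by rw [pullback_one]
  mul_mem' {g h} hg hh R := by rw [pullback_mul, hh, hg]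
  inv_mem' {g} hg R := by
    rw [← hg, ← pullback_mul, inv_mul_cancel, pullback_one]

/-- A permutation that commutes with the decoder on a dense set of LLR vectors respects
decodability of erasure patterns. -/
lemma mem_erasureSymm_of_dense {m : ℕ} (I : Finset (Bits m)) (π : Equiv.Perm (Bits m))
    (h : Dense {y : Bits m → ℝ | SC m I (permute π y) = permute π (SC m I y)}) :
    π ∈ erasureSymm I := by
  intro R
  set K : ℝ := 3 ^ m * 1 + m + 1
  have hK : (3 : ℝ) ^ m * 1 + m < K := by simp only [K]; linarith
  have hreg : ∀ y ∈ receivedRegion R K 1, permute π y ∈ receivedRegion (pullback π R) K 1 := by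
    intro y hy a
    rw [mem_pullback]
    exact hy (π a)
  have hreg' : ∀ y, permute π y ∈ receivedRegion (pullback π R) K 1 →
      y ∈ receivedRegion R K 1 := by
    intro y hy a
    have := hy (π.symm a)
    rw [mem_pullback] at this
    simpa [permute] using this
  have hcont : Continuous fun y : Bits m → ℝ => permute π y :=
    continuous_pi fun a => continuous_apply (π a)
  constructor
  · intro hI
    by_contra hR
    obtain ⟨V, hVo, hVn, hVR, hV⟩ := exists_isOpen_SC_ne_zero m I R K 1 one_pos hK hR
    obtain ⟨y, hyV, hy⟩ := h.inter_open_nonempty V hVo hVn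
    have h0 := SC_eq_zero_of_subset_unerased m I _ K 1 one_pos hK hI _ (hreg y (hVR hyV))
    refine hV y hyV ?_
    rw [hy] at h0
    funext a
    have := congrFun h0 (π.symm a)
    simpa [permute] using this
  · intro hI
    by_contra hR
    obtain ⟨V, hVo, ⟨z, hz⟩, hVR, hV⟩ :=
      exists_isOpen_SC_ne_zero m I (pullback π R) K 1 one_pos hK hR
    obtain ⟨y, hyV, hy⟩ := h.inter_open_nonempty _ (hVo.preimage hcont)
      ⟨permute π.symm z, by
        have : permute π (permute π.symm z) = z := by funext a; simp [permute]
        rwa [Set.mem_preimage, this]⟩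
    have h0 := SC_eq_zero_of_subset_unerased m I _ K 1 one_pos hK hI y (hreg' y (hVR hyV))
    refine hV _ hyV ?_
    rw [hy, h0]
    rfl

/-! ### Symmetries of the decoding condition -/

/-- The triangular permutation `a ↦ a + φ(a) e_j`, where `φ` does not depend on `a_j`. -/
def triangularPerm {m : ℕ} (j : ℕ) (φ : Bits m → ZMod 2)
    (hφ : ∀ a, φ (a + unitBits m j) = φ a) : Equiv.Perm (Bits m) :=
  Function.Involutive.toPerm (fun a => if φ a = 1 then a + unitBits m j else a) fun a => by
    by_cases h : φ a = 1 <;> simp [h, hφ]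

lemma triangularPerm_apply {m j : ℕ} {φ : Bits m → ZMod 2} (hφ : ∀ a, φ (a + unitBits m j) = φ a)
    (a : Bits m) :
    triangularPerm j φ hφ a = if φ a = 1 then a + unitBits m j else a := rfl

lemma triangularPerm_add_unitBits {m j t : ℕ} {φ : Bits m → ZMod 2}
    (hφ : ∀ a, φ (a + unitBits m j) = φ a) (ht : ∀ a, φ (a + unitBits m t) = φ a) (a : Bits m) :
    triangularPerm j φ hφ (a + unitBits m t) = triangularPerm j φ hφ a + unitBits m t := by
  rw [triangularPerm_apply, triangularPerm_apply, ht]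
  split_ifs
  · rw [add_right_comm]
  · rfl

lemma triangularPerm_apply_of_ne {m j : ℕ} {φ : Bits m → ZMod 2}
    (hφ : ∀ a, φ (a + unitBits m j) = φ a) (a : Bits m) {i : Fin m} (hi : (i : ℕ) ≠ j) :
    triangularPerm j φ hφ a i = a i := by
  rw [triangularPerm_apply]
  split_ifs
  · exact add_unitBits_apply_of_ne a hi
  · rfl

/-- If `φ` depends only on the coordinates before `j`, the triangular permutation moves points along
lines in direction `j`, and it commutes with the down-shifts in the directions after `j`. -/
lemma unerased_pullback_triangularPerm {m j : ℕ} (hj : j < m) {φ : Bits m → ZMod 2}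
    (hφ : ∀ t, j ≤ t → ∀ a, φ (a + unitBits m t) = φ a) (R : Finset (Bits m)) :
    unerased (pullback (triangularPerm j φ (hφ j le_rfl)) R) = unerased R := by
  set τ := triangularPerm j φ (hφ j le_rfl) with hτ
  have h1 : ∀ t, j < t → ∀ X, downShift t (pullback τ X) = pullback τ (downShift t X) := by
    intro t ht X
    ext a
    have h : (∃ i : Fin m, (i : ℕ) = t ∧ τ a i = 0) ↔ ∃ i : Fin m, (i : ℕ) = t ∧ a i = 0 := by
      refine exists_congr fun i => and_congr_right fun hi => ?_
      rw [hτ, triangularPerm_apply_of_ne _ _ (by omega)]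
    simp only [downShift, mem_pullback, Finset.mem_filter, Finset.mem_univ, true_and, h]
    rw [hτ, triangularPerm_add_unitBits _ (hφ t ht.le)]
  have h2 : ∀ l : List ℕ, (∀ t ∈ l, j < t) →
      shiftAll l (pullback τ R) = pullback τ (shiftAll l R) := by
    intro l hl
    induction l with
    | nil => rfl
    | cons t l ih =>
      rw [shiftAll_cons, ih fun s hs => hl s (List.mem_cons_of_mem _ hs), h1 t (hl t (by simp)),
        shiftAll_cons]
  have h3 : ∀ X, downShift j (pullback τ X) = downShift j X := by
    intro X
    ext a
    simp only [downShift, mem_pullback, Finset.mem_filter, Finset.mem_univ, true_and]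
    rw [hτ, triangularPerm_add_unitBits _ (hφ j le_rfl), triangularPerm_apply]
    split_ifs
    · rw [bits_add_add_cancel]
      tauto
    · rfl
  rw [unerased_eq_shiftAll_shiftAll hj, unerased_eq_shiftAll_shiftAll hj, List.range_succ,
    shiftAll_append, shiftAll_append, h2 _ fun t ht => by
      have := List.mem_range'_1.1 ht
      omega]
  congr 1
  exact h3 _

lemma triangularPerm_mem_erasureSymm {m j : ℕ} (I : Finset (Bits m)) (hj : j < m)
    {φ : Bits m → ZMod 2} (hφ : ∀ t, j ≤ t → ∀ a, φ (a + unitBits m t) = φ a) :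
    triangularPerm j φ (hφ j le_rfl) ∈ erasureSymm I := fun R => by
  rw [unerased_pullback_triangularPerm hj hφ]

lemma mem_addSubgroup_of_unitBits {m : ℕ} (A : AddSubgroup (Bits m)) (p : ℕ)
    (h : ∀ j : Fin m, p ≤ (j : ℕ) → unitBits m j ∈ A) {x : Bits m}
    (hx : ∀ i : Fin m, (i : ℕ) < p → x i = 0) : x ∈ A := by
  rw [← Finset.univ_sum_single x]
  refine sum_mem fun i _ => ?_
  rcases zmod_two_cases (x i) with h0 | h0
  · rw [h0, Pi.single_zero]; exact zero_mem _
  · have hi : p ≤ (i : ℕ) := by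
      by_contra hlt
      rw [hx i (by omega)] at h0
      exact zero_ne_one h0
    have : (Pi.single i (x i) : Bits m) = unitBits m i := by
      funext k
      rw [h0]
      by_cases hk : k = i
      · subst hk; simp
      · rw [Pi.single_eq_of_ne hk, unitBits_apply_of_ne fun h' => hk (Fin.ext h')]
    rw [this]
    exact h i hi

lemma addRight_mem_erasureSymm {m : ℕ} (I : Finset (Bits m)) (v : Bits m) :
    Equiv.addRight v ∈ erasureSymm I := by
  let A : AddSubgroup (Bits m) :=
    { carrier := {v | Equiv.addRight v ∈ erasureSymm I}
      zero_mem' := by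
        have : Equiv.addRight (0 : Bits m) = 1 := by ext; simp
        change Equiv.addRight (0 : Bits m) ∈ erasureSymm I
        rw [this]; exact one_mem _
      add_mem' := by
        intro a b ha hb
        have : Equiv.addRight (a + b) = Equiv.addRight b * Equiv.addRight a := by
          ext x : 1; simp [add_assoc]
        change Equiv.addRight (a + b) ∈ erasureSymm I
        rw [this]; exact mul_mem hb ha
      neg_mem' := by
        intro a ha
        have : -a = a := neg_eq_of_add_eq_zero_left (bits_add_self a)
        rwa [this] }
  refine mem_addSubgroup_of_unitBits A 0 (fun j _ => ?_) (fun i hi => absurd hi (by omega))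
  have := triangularPerm_mem_erasureSymm I j.2 (φ := fun _ => 1) fun _ _ _ => rfl
  change Equiv.addRight (unitBits m j) ∈ erasureSymm I
  convert this using 1
  ext a : 1
  simp [triangularPerm_apply]

lemma swap_map_mem {m : ℕ} {I : Finset (Bits m)} {g : Equiv.Perm (Bits m)} (hg : g ∈ erasureSymm I)
    {x y : Bits m} (h : Equiv.swap x y ∈ erasureSymm I) :
    Equiv.swap (g x) (g y) ∈ erasureSymm I := by
  rw [Equiv.swap_apply_apply]
  exact mul_mem (mul_mem hg h) (inv_mem hg)

lemma swap_trans_mem {m : ℕ} {I : Finset (Bits m)} {x y z : Bits m}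
    (h : Equiv.swap x y ∈ erasureSymm I) (h' : Equiv.swap y z ∈ erasureSymm I) :
    Equiv.swap x z ∈ erasureSymm I := by
  by_cases hxy : x = y
  · rwa [hxy]
  by_cases hxz : x = z
  · rw [hxz, Equiv.swap_self]; exact one_mem _
  have := swap_map_mem h h'
  by_cases hyz : y = z
  · rwa [← hyz]
  rwa [Equiv.swap_apply_right, Equiv.swap_apply_of_ne_of_ne (Ne.symm hxz) (Ne.symm hyz)] at this

/-- The vectors `v` such that all transpositions of `x` and `x + v` are symmetries of the decoding
condition.  Translations are symmetries, so it is enough to consider `x = 0`. -/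
def swapDirections {m : ℕ} (I : Finset (Bits m)) : AddSubgroup (Bits m) where
  carrier := {v | Equiv.swap 0 v ∈ erasureSymm I}
  zero_mem' := by
    change Equiv.swap 0 0 ∈ erasureSymm I
    rw [Equiv.swap_self]; exact one_mem _
  add_mem' {v w} hv hw := by
    refine swap_trans_mem hv ?_
    have := swap_map_mem (addRight_mem_erasureSymm I v) hw
    simpa [add_comm] using this
  neg_mem' {v} hv := by
    have : -v = v := neg_eq_of_add_eq_zero_left (bits_add_self v)
    rwa [this]

lemma mem_swapDirections {m : ℕ} {I : Finset (Bits m)} {v : Bits m} :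
    v ∈ swapDirections I ↔ Equiv.swap 0 v ∈ erasureSymm I := Iff.rfl

lemma swap_mem_of_mem_swapDirections {m : ℕ} {I : Finset (Bits m)} {x y : Bits m}
    (h : y - x ∈ swapDirections I) : Equiv.swap x y ∈ erasureSymm I := by
  have := swap_map_mem (addRight_mem_erasureSymm I x) h
  simpa using this

lemma map_mem_swapDirections {m : ℕ} {I : Finset (Bits m)} {g : Equiv.Perm (Bits m)}
    (hg : g ∈ erasureSymm I) (h0 : g 0 = 0) {v : Bits m} (hv : v ∈ swapDirections I) :
    g v ∈ swapDirections I := by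
  have := swap_map_mem hg hv
  rwa [h0] at this

/-- The last direction: the decoder treats the two positions of a line in this direction
symmetrically. -/
lemma unitBits_last_mem_swapDirections {m : ℕ} (I : Finset (Bits m)) {j : ℕ} (hj : j + 1 = m) :
    unitBits m j ∈ swapDirections I := by
  classical
  have hφ : ∀ t, j ≤ t → ∀ a : Bits m,
      (if ∀ i : Fin m, (i : ℕ) < j → (a + unitBits m t) i = 0 then 1 else 0 : ZMod 2) =
        if ∀ i : Fin m, (i : ℕ) < j → a i = 0 then 1 else 0 := by
    intro t ht a
    refine if_congr (forall_congr' fun i => imp_congr_right fun hi => ?_) rfl rfl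
    rw [add_unitBits_apply_of_ne _ (by omega)]
  have := triangularPerm_mem_erasureSymm I (by omega : j < m)
    (φ := fun a => if ∀ i : Fin m, (i : ℕ) < j → a i = 0 then 1 else 0) hφ
  rw [mem_swapDirections]
  convert this using 1
  ext a : 1
  rw [triangularPerm_apply]
  have h1 : (∀ i : Fin m, (i : ℕ) < j → a i = 0) ↔ a = 0 ∨ a = unitBits m j := by
    constructor
    · intro h
      have hl : ∀ i : Fin m, ¬ (i : ℕ) < j → i = ⟨j, by omega⟩ := fun i hi =>
        Fin.ext (by have := i.2; simp only; omega)
      rcases zmod_two_cases (a ⟨j, by omega⟩) with h0 | h0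
      · left
        funext i
        by_cases hi : (i : ℕ) < j
        · exact h i hi
        · rw [hl i hi, h0]; rfl
      · right
        funext i
        by_cases hi : (i : ℕ) < j
        · rw [h i hi, unitBits_apply_of_ne (by omega)]
        · rw [hl i hi, h0]; simp [unitBits]
    · rintro (rfl | rfl) i hi
      · rfl
      · exact unitBits_apply_of_ne (by omega)
  by_cases h : ∀ i : Fin m, (i : ℕ) < j → a i = 0
  · rw [if_pos h, if_pos rfl]
    rcases h1.1 h with rfl | rfl
    · simp
    · simp [bits_add_self]
  · rw [if_neg h, if_neg zero_ne_one]
    rw [h1, not_or] at h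
    exact Equiv.swap_apply_of_ne_of_ne h.1 h.2

/-- The linear permutation `π` is block lower-triangular with a cut at `p`: it preserves the space
of the vectors whose first `p` coordinates vanish. -/
def IsCut {m : ℕ} (π : Bits m ≃+ Bits m) (p : ℕ) : Prop :=
  ∀ x : Bits m, (∀ i : Fin m, (i : ℕ) < p → x i = 0) → ∀ i : Fin m, (i : ℕ) < p → π x i = 0

/-- If `π` has no cut between `S` and `m`, then the symmetries include all transpositions of vectors
with the same first `S` coordinates: the set of directions of transpositions is a space that is
invariant under `π` and under all lower unitriangular matrices, so it is spanned by the last unit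
vectors from a cut of `π` on. -/
lemma swap_mem_erasureSymm {m S : ℕ} (hS : S < m) (I : Finset (Bits m)) (π : Bits m ≃+ Bits m)
    (hπ : π.toEquiv ∈ erasureSymm I) (hcut : ∀ p, S < p → p < m → ¬ IsCut π p) {x y : Bits m}
    (hxy : ∀ i : Fin m, (i : ℕ) < S → x i = y i) : Equiv.swap x y ∈ erasureSymm I := by
  have key : ∀ n p, p + (n + 1) = m → S ≤ p →
      ∀ j : Fin m, p ≤ (j : ℕ) → unitBits m j ∈ swapDirections I := by
    intro n
    induction n with
    | zero =>
      intro p hp _ j hj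
      exact unitBits_last_mem_swapDirections I (by have := j.2; omega)
    | succ n ih =>
      intro p hp hSp
      have ih := ih (p + 1) (by omega) (by omega)
      have hp' : p < m := by omega
      have hnc := hcut (p + 1) (by omega) (by omega)
      simp only [IsCut, not_forall] at hnc
      obtain ⟨z, hz, i, hi, hiz⟩ := hnc
      set v := π z
      have hv : v ∈ swapDirections I :=
        map_mem_swapDirections hπ (map_zero π) (mem_addSubgroup_of_unitBits _ _ ih hz)
      have hup : unitBits m p ∈ swapDirections I := by
        by_cases hex : ∃ i : Fin m, (i : ℕ) < p ∧ v i ≠ 0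
        · obtain ⟨i, hip, hiv⟩ := hex
          have hφ : ∀ t, p ≤ t → ∀ a : Bits m, (a + unitBits m t) i = a i := fun t ht a =>
            add_unitBits_apply_of_ne a (by omega)
          have hg := triangularPerm_mem_erasureSymm I hp' (φ := fun a => a i) hφ
          have := map_mem_swapDirections hg (by rw [triangularPerm_apply]; simp) hv
          rw [triangularPerm_apply, if_pos (zmod_two_ne_zero.1 hiv)] at this
          simpa using sub_mem this hv
        · push Not at hex
          have hip : (i : ℕ) = p := by
            by_contra hne
            exact hiz (hex i (by omega))
          have hrest : v + unitBits m p ∈ swapDirections I := by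
            refine mem_addSubgroup_of_unitBits _ (p + 1) ih fun k hk => ?_
            by_cases hkp : (k : ℕ) = p
            · have hki : k = i := Fin.ext (hkp.trans hip.symm)
              rw [hki, ← hip, add_unitBits_apply_self, zmod_two_ne_zero.1 hiz,
                CharTwo.add_self_eq_zero]
            · rw [add_unitBits_apply_of_ne _ hkp, hex k (by omega)]
          simpa using sub_mem hrest hv
      intro j hj
      by_cases hjp : (j : ℕ) = p
      · rwa [hjp]
      · exact ih j (by omega)
  refine swap_mem_of_mem_swapDirections
    (mem_addSubgroup_of_unitBits _ S (key (m - S - 1) S (by omega) le_rfl) fun i hi => ?_)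
  rw [Pi.sub_apply, hxy i hi, sub_self]

/-- If all transpositions inside a set `φ` are symmetries, then only the number of received
positions inside `φ` matters. -/
lemma subset_unerased_of_card_eq {m : ℕ} {I : Finset (Bits m)} {φ : Bits m → Prop}
    (hswap : ∀ x y, φ x → φ y → Equiv.swap x y ∈ erasureSymm I) (R R' : Finset (Bits m))
    (hRR' : ∀ a, ¬ φ a → (a ∈ R ↔ a ∈ R')) (hcard : R.card = R'.card)
    (hR : I ⊆ unerased R) : I ⊆ unerased R' := by
  induction hn : (R \ R').card generalizing R with
  | zero =>
    have hsub : R ⊆ R' := by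
      rwa [Finset.card_eq_zero, Finset.sdiff_eq_empty_iff_subset] at hn
    rwa [← Finset.eq_of_subset_of_card_le hsub hcard.ge]
  | succ n ih =>
    obtain ⟨x, hx⟩ : (R \ R').Nonempty := by rw [← Finset.card_pos]; omega
    obtain ⟨y, hy⟩ : (R' \ R).Nonempty := by
      rw [← Finset.card_pos, ← Finset.card_sdiff_comm hcard]; omega
    rw [Finset.mem_sdiff] at hx hy
    have hφx : φ x := by
      by_contra h
      exact hx.2 ((hRR' x h).1 hx.1)
    have hφy : φ y := by
      by_contra h
      exact hy.2 ((hRR' y h).2 hy.1)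
    have hnew : pullback (Equiv.swap x y) R = insert y (R.erase x) := by
      ext a
      rw [mem_pullback, Finset.mem_insert, Finset.mem_erase]
      by_cases hax : a = x
      · subst hax
        have : a ≠ y := fun h => hy.2 (h ▸ hx.1)
        simp [this, hy.2]
      · by_cases hay : a = y
        · subst hay; simp [hx.1]
        · rw [Equiv.swap_apply_of_ne_of_ne hax hay]
          simp [hax, hay]
    refine ih (insert y (R.erase x)) (fun a ha => ?_) ?_ ?_ ?_
    · have hax : a ≠ x := fun h => ha (h ▸ hφx)
      have hay : a ≠ y := fun h => ha (h ▸ hφy)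
      simp [hax, hay, hRR' a ha]
    · rw [Finset.card_insert_of_notMem (by simp [hy.2]), Finset.card_erase_add_one hx.1, hcard]
    · rw [← hnew]
      exact (hswap x y hφx hφy R).2 hR
    · have : insert y (R.erase x) \ R' = (R \ R').erase x := by
        rw [Finset.insert_sdiff_of_mem _ hy.1, Finset.erase_sdiff_comm]
      rw [this, Finset.card_erase_of_mem (Finset.mem_sdiff.2 hx), hn]
      rfl

/-! ### Decreasing sets -/

lemma mem_monoSupp {m : ℕ} {a : Bits m} {i : Fin m} : i ∈ monoSupp a ↔ a i = 1 := by
  simp [monoSupp]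

/-- Two sets of the same size are comparable if every initial segment contains at least as many
elements of the first set as of the second. -/
lemma monoLESameDegree_of_card_le {m : ℕ} {f g : Bits m}
    (hcard : (monoSupp f).card = (monoSupp g).card)
    (h : ∀ v : Fin m, ((monoSupp g).filter (· ≤ v)).card ≤ ((monoSupp f).filter (· ≤ v)).card) :
    MonoLESameDegree f g := by
  set ef := (monoSupp f).orderEmbOfFin hcard
  set eg := (monoSupp g).orderEmbOfFin rfl
  refine ⟨_, ef, eg, ef.strictMono, eg.strictMono, ?_, ?_, fun l => ?_⟩
  · ext x
    have : x ∈ Set.range ef ↔ x ∈ (monoSupp f : Set (Fin m)) := by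
      rw [Finset.range_orderEmbOfFin]
    simpa using this.symm
  · ext x
    have : x ∈ Set.range eg ↔ x ∈ (monoSupp g : Set (Fin m)) := by
      rw [Finset.range_orderEmbOfFin]
    simpa using this.symm
  · by_contra hlt
    rw [not_le] at hlt
    have h1 : (Finset.univ.filter (· ≤ l)).image eg ⊆ (monoSupp g).filter (· ≤ eg l) := by
      intro x hx
      obtain ⟨k, hk, rfl⟩ := Finset.mem_image.1 hx
      rw [Finset.mem_filter] at hk ⊢
      exact ⟨Finset.orderEmbOfFin_mem _ _ _, eg.monotone hk.2⟩
    have h2 : (monoSupp f).filter (· ≤ eg l) ⊆ (Finset.univ.filter (· < l)).image ef := by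
      intro x hx
      rw [Finset.mem_filter] at hx
      have : x ∈ Set.range ef := by
        rw [Finset.range_orderEmbOfFin]; exact hx.1
      obtain ⟨k, rfl⟩ := this
      refine Finset.mem_image_of_mem _ (Finset.mem_filter.2 ⟨Finset.mem_univ _, ?_⟩)
      exact ef.lt_iff_lt.1 (hx.2.trans_lt hlt)
    have h3 := Finset.card_le_card h1
    have h4 := Finset.card_le_card h2
    rw [Finset.card_image_of_injective _ eg.injective] at h3
    rw [Finset.card_image_of_injective _ ef.injective] at h4
    have h5 : (Finset.univ.filter (· < l)).card < (Finset.univ.filter (· ≤ l)).card := by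
      refine Finset.card_lt_card ⟨fun x hx => ?_, fun hsub => ?_⟩
      · rw [Finset.mem_filter] at hx ⊢
        exact ⟨hx.1, hx.2.le⟩
      · have := hsub (Finset.mem_filter.2 ⟨Finset.mem_univ l, le_rfl⟩)
        exact lt_irrefl _ (Finset.mem_filter.1 this).2
    have := h (eg l)
    omega

lemma monoLE_of_le {m : ℕ} {f g : Bits m} (h : ∀ i, f i = 1 → g i = 1) : MonoLE f g :=
  ⟨f, fun i hi => mem_monoSupp.2 (h i (mem_monoSupp.1 hi)),
    monoLESameDegree_of_card_le rfl fun _ => le_rfl⟩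

/-- Closure of a set of monomials under dropping variables and under replacing a variable by an
earlier one.  This holds for decreasing sets, and it passes directly to the information sets of
subcodes. -/
structure IsMoveClosed {m : ℕ} (I : Finset (Bits m)) : Prop where
  /-- Variables can be dropped. -/
  mem_of_le : ∀ {x y : Bits m}, x ∈ I → (∀ i, y i = 1 → x i = 1) → y ∈ I
  /-- A variable can be replaced by an earlier one, and then some variables can be dropped. -/
  mem_of_replace : ∀ {x y : Bits m}, x ∈ I → ∀ {i j : Fin m}, i < j → x j = 1 →
    (∀ k, y k = 1 → k = i ∨ (k ≠ j ∧ x k = 1)) → y ∈ I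

lemma IsDecreasing.mem_of_le {m : ℕ} {I : Finset (Bits m)} (hI : IsDecreasing I) {x y : Bits m}
    (hx : x ∈ I) (h : ∀ i, y i = 1 → x i = 1) : y ∈ I :=
  hI x hx y (monoLE_of_le h)

lemma IsDecreasing.mem_of_replace {m : ℕ} {I : Finset (Bits m)} (hI : IsDecreasing I)
    {x y : Bits m} (hx : x ∈ I) {i j : Fin m} (hij : i < j) (hj : x j = 1)
    (h : ∀ k, y k = 1 → k = i ∨ (k ≠ j ∧ x k = 1)) : y ∈ I := by
  rcases zmod_two_cases (x i) with hi | hi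
  swap
  · refine hI.mem_of_le hx fun k hk => ?_
    rcases h k hk with rfl | h1
    · exact hi
    · exact h1.2
  set z : Bits m := fun k => if k = i then 1 else if k = j then 0 else x k
  have hz : monoSupp z = insert i ((monoSupp x).erase j) := by
    ext k
    rw [mem_monoSupp, Finset.mem_insert, Finset.mem_erase, mem_monoSupp]
    by_cases hki : k = i
    · simp [z, hki]
    · by_cases hkj : k = j <;> simp [z, hki, hkj]
  have hzx : MonoLE z x := by
    refine ⟨x, subset_rfl, monoLESameDegree_of_card_le ?_ fun v => ?_⟩
    · rw [hz, Finset.card_insert_of_notMem (by simp [mem_monoSupp, hi]),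
        Finset.card_erase_add_one (mem_monoSupp.2 hj)]
    · refine Finset.card_le_card_of_injOn (fun k => if k = j then i else k) (fun k hk => ?_)
        (fun k hk l hl hkl => ?_)
      · rw [Finset.mem_coe, Finset.mem_filter] at hk
        rw [Finset.mem_coe, Finset.mem_filter, hz, Finset.mem_insert, Finset.mem_erase]
        by_cases hkj : k = j
        · subst hkj
          simpa using hij.le.trans hk.2
        · simp only [hkj, if_false]
          exact ⟨Or.inr ⟨hkj, hk.1⟩, hk.2⟩
      · have hk' : k ≠ i := by
          rintro rfl
          rw [Finset.mem_coe, Finset.mem_filter, mem_monoSupp, hi] at hk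
          exact zero_ne_one hk.1
        have hl' : l ≠ i := by
          rintro rfl
          rw [Finset.mem_coe, Finset.mem_filter, mem_monoSupp, hi] at hl
          exact zero_ne_one hl.1
        simp only at hkl
        split_ifs at hkl with h1 h2 h2
        · rw [h1, h2]
        · exact absurd hkl.symm hl'
        · exact absurd hkl hk'
        · exact hkl
  refine hI.mem_of_le (hI x hx z hzx) fun k hk => ?_
  rcases h k hk with rfl | h1
  · simp [z]
  · by_cases hki : k = i
    · simp [z, hki]
    · simp [z, hki, h1.1, h1.2]

lemma IsDecreasing.isMoveClosed {m : ℕ} {I : Finset (Bits m)} (hI : IsDecreasing I) :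
    IsMoveClosed I :=
  ⟨fun hx h => hI.mem_of_le hx h, fun hx _ _ hij hj h => hI.mem_of_replace hx hij hj h⟩

lemma IsMoveClosed.subInfo {m S : ℕ} (hS : S ≤ m) {I : Finset (Bits m)} (hI : IsMoveClosed I)
    (c : ZMod 2) : IsMoveClosed (subInfo S c I) where
  mem_of_le {x y} hx h := by
    rw [subInfo_mem] at hx ⊢
    refine hI.mem_of_le hx fun i hi => ?_
    rcases lt_or_ge (i : ℕ) S with hiS | hiS
    · rw [fillTop_apply_of_lt _ _ hiS] at hi ⊢
      exact h _ hi
    · rwa [fillTop_apply_of_le _ _ hiS] at hi ⊢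
  mem_of_replace {x y} hx i j hij hj h := by
    rw [subInfo_mem] at hx ⊢
    refine hI.mem_of_replace hx (i := Fin.castLE hS i) (j := Fin.castLE hS j) hij
      (by rwa [fillTop_apply_of_lt _ _ (by simp)]) fun k hk => ?_
    rcases lt_or_ge (k : ℕ) S with hkS | hkS
    · rw [fillTop_apply_of_lt _ _ hkS] at hk ⊢
      refine (h _ hk).imp (fun h1 => ?_) fun h1 => ⟨fun h2 => h1.1 ?_, h1.2⟩
      · rw [← h1]; rfl
      · rw [Fin.ext_iff] at h2 ⊢
        exact h2
    · rw [fillTop_apply_of_le _ _ hkS] at hk ⊢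
      refine Or.inr ⟨fun h2 => ?_, hk⟩
      rw [h2, Fin.val_castLE] at hkS
      exact absurd j.2 (not_lt.2 hkS)

lemma IsMoveClosed.isLowerIn {m : ℕ} {I : Finset (Bits m)} (hI : IsMoveClosed I) (l : List ℕ) :
    IsLowerIn l I := by
  intro i _ a ha hai
  refine hI.mem_of_le ha fun k hk => ?_
  by_cases hki : k = i
  · rwa [hki]
  · rwa [add_unitBits_apply_of_ne _ fun h => hki (Fin.ext h)] at hk

/-! ### The last block -/

/-- The vector with the first `S` coordinates of `b` and the remaining coordinates of `h`. -/
def spliceBits {m : ℕ} (S : ℕ) (b h : Bits m) : Bits m := fun i => if (i : ℕ) < S then b i else h i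

lemma spliceBits_of_lt {m S : ℕ} (b h : Bits m) {i : Fin m} (hi : (i : ℕ) < S) :
    spliceBits S b h i = b i := by
  simp [spliceBits, hi]

lemma spliceBits_of_le {m S : ℕ} (b h : Bits m) {i : Fin m} (hi : S ≤ (i : ℕ)) :
    spliceBits S b h i = h i := by
  simp [spliceBits, not_lt.2 hi]

lemma eq_spliceBits {m S : ℕ} {a b h : Bits m} (hb : ∀ i : Fin m, (i : ℕ) < S → a i = b i)
    (hh : ∀ i : Fin m, S ≤ (i : ℕ) → a i = h i) : a = spliceBits S b h := by
  funext i
  rcases lt_or_ge (i : ℕ) S with hi | hi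
  · rw [spliceBits_of_lt _ _ hi, hb i hi]
  · rw [spliceBits_of_le _ _ hi, hh i hi]

/-- If all transpositions among vectors with the same first `S` coordinates are symmetries, then a
move-closed set that meets such a fiber in a further point besides the smallest one contains all of
the fiber, except possibly the largest point.  Otherwise the fiber of `I` could be replaced by a set
of the same size that either lies in the half-fiber `a_{S+1} = 0` or contains it, and this would
change the set of unerased bit channels. -/
lemma spliceBits_compl_mem {m S : ℕ} (hS : S < m) {I : Finset (Bits m)} (hI : IsMoveClosed I)
    (hswap : ∀ x y : Bits m, (∀ i : Fin m, (i : ℕ) < S → x i = y i) →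
      Equiv.swap x y ∈ erasureSymm I) {b : Bits m}
    (hb : spliceBits S b (unitBits m S) ∈ I) : spliceBits S b (1 + unitBits m S) ∈ I := by
  classical
  by_contra hb'
  set s : Fin m := ⟨S, hS⟩ with hs
  set φ : Bits m → Prop := fun a => ∀ i : Fin m, (i : ℕ) < S → a i = b i with hφ
  have hφinv : ∀ t, S ≤ t → ∀ a, φ (a + unitBits m t) ↔ φ a := fun t ht a =>
    forall_congr' fun i => imp_congr_right fun hi => by rw [add_unitBits_apply_of_ne _ (by omega)]
  set l := List.range' S (m - S) with hl
  have hlS : ∀ t ∈ l, S ≤ t := fun t ht => (List.mem_range'_1.1 ht).1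
  set H : Finset (Bits m) := Finset.univ.filter fun a => φ a ∧ a s = 0 with hH
  have hIlow : ∀ l, shiftAll l I = I := fun l => shiftAll_eq_self (hI.isLowerIn l)
  have hcardsplit : ∀ X : Finset (Bits m), (X.filter φ).card + (X.filter fun a => ¬ φ a).card
      = X.card := fun X => Finset.card_filter_add_card_filter_not _
  -- A replacement `X` for the fiber of `I` does not change the unerased bit channels.
  have main : ∀ X : Finset (Bits m), (∀ a ∈ X, φ a) → X.card = (I.filter φ).card →
      unerased (X ∪ I.filter fun a => ¬ φ a) = I := by
    intro X hX hXc
    have hdisj : Disjoint X (I.filter fun a => ¬ φ a) :=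
      Finset.disjoint_left.2 fun a ha ha' => (Finset.mem_filter.1 ha').2 (hX a ha)
    have hc : (X ∪ I.filter fun a => ¬ φ a).card = I.card := by
      rw [Finset.card_union_of_disjoint hdisj, hXc, hcardsplit]
    have hsub : I ⊆ unerased (X ∪ I.filter fun a => ¬ φ a) := by
      refine subset_unerased_of_card_eq (φ := φ)
        (fun x y hx hy => hswap x y fun i hi => (hx i hi).trans (hy i hi).symm) I _
        (fun a ha => ?_) hc.symm (hIlow _).ge
      have haX : a ∉ X := fun h => ha (hX a h)
      simp [ha, haX]
    exact (Finset.eq_of_subset_of_card_le hsub (by rw [card_unerased, hc])).symm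
  have main' : ∀ X : Finset (Bits m), (∀ a ∈ X, φ a) → X.card = (I.filter φ).card →
      (∀ a, ¬ φ a → (a ∈ shiftAll l (X ∪ I.filter fun a => ¬ φ a) ↔ a ∈ I)) ∧
      ∀ h : Bits m, ((shiftAll l (X ∪ I.filter fun a => ¬ φ a)).filter
        fun a => ∀ i : Fin m, S ≤ (i : ℕ) → a i = h i).card =
        (I.filter fun a => ∀ i : Fin m, S ≤ (i : ℕ) → a i = h i).card := by
    intro X hX hXc
    refine ⟨fun a ha => ?_, fun h => ?_⟩
    · rw [mem_shiftAll_congr (φ := fun a => ¬ φ a) (R' := I)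
        (fun t ht a => not_congr (hφinv t (hlS t ht) a)) (fun a ha => ?_) ha, hIlow]
      have haX : a ∉ X := fun h => ha (hX a h)
      simp [ha, haX]
    · conv_rhs => rw [← main X hX hXc, unerased_eq_shiftAll_shiftAll hS.le]
      refine (card_filter_shiftAll _ _ _ fun t ht a => ?_).symm
      rw [List.mem_range] at ht
      refine forall_congr' fun i => imp_congr_right fun hi => ?_
      rw [add_unitBits_apply_of_ne _ (by omega)]
  rcases le_total (I.filter φ).card H.card with hle | hle
  · obtain ⟨X, hXH, hXc⟩ := Finset.exists_subset_card_eq hle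
    have hX : ∀ a ∈ X, φ a := fun a ha => (Finset.mem_filter.1 (hXH ha)).2.1
    obtain ⟨h1, h2⟩ := main' X hX hXc
    set Z := shiftAll l (X ∪ I.filter fun a => ¬ φ a) with hZ
    have hZY : Z ⊆ Finset.univ.filter fun a => ¬ φ a ∨ a s = 0 := by
      have hlow : IsLowerIn l (Finset.univ.filter fun a => ¬ φ a ∨ a s = 0) := by
        intro i hi a ha hai
        rw [Finset.mem_filter] at ha ⊢
        refine ⟨Finset.mem_univ _, ha.2.imp (fun h => ?_) fun h => ?_⟩
        · rwa [hφinv i (hlS i hi)]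
        · have : (s : ℕ) ≠ i := by
            intro hsi
            rw [Fin.ext hsi, hai] at h
            exact one_ne_zero h
          rwa [add_unitBits_apply_of_ne _ this]
      rw [← shiftAll_eq_self hlow]
      refine shiftAll_mono l fun a ha => ?_
      rw [Finset.mem_filter]
      refine ⟨Finset.mem_univ _, ?_⟩
      rcases Finset.mem_union.1 ha with ha | ha
      · exact Or.inr (Finset.mem_filter.1 (hXH ha)).2.2
      · exact Or.inl (Finset.mem_filter.1 ha).2
    have h3 := h2 (unitBits m S)
    refine absurd h3 (Finset.card_lt_card ⟨fun a ha => ?_, fun hsub => ?_⟩).ne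
    · rw [Finset.mem_filter] at ha ⊢
      refine ⟨?_, ha.2⟩
      by_cases hφa : φ a
      · rw [eq_spliceBits hφa ha.2]; exact hb
      · exact (h1 a hφa).1 ha.1
    · have hmem := hsub (Finset.mem_filter.2 ⟨hb, fun i hi => spliceBits_of_le _ _ hi⟩)
      have := (Finset.mem_filter.1 (hZY (Finset.mem_filter.1 hmem).1)).2
      rcases this with h | h
      · exact h fun i hi => spliceBits_of_lt _ _ hi
      · rw [spliceBits_of_le _ _ (by simp [hs])] at h
        simp [unitBits, hs] at h
  · have hHF : H ⊆ Finset.univ.filter φ := fun a ha =>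
      Finset.mem_filter.2 ⟨Finset.mem_univ _, (Finset.mem_filter.1 ha).2.1⟩
    obtain ⟨X, hHX, hXF, hXc⟩ := Finset.exists_subsuperset_card_eq hHF hle
      (Finset.card_le_card (Finset.filter_subset_filter φ (Finset.subset_univ I)))
    have hX : ∀ a ∈ X, φ a := fun a ha => (Finset.mem_filter.1 (hXF ha)).2
    obtain ⟨h1, h2⟩ := main' X hX hXc
    set Z := shiftAll l (X ∪ I.filter fun a => ¬ φ a) with hZ
    have hHZ : H ⊆ Z := by
      have hlow : IsLowerIn l H := by
        intro i hi a ha hai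
        rw [hH, Finset.mem_filter] at ha ⊢
        refine ⟨Finset.mem_univ _, (hφinv i (hlS i hi) a).2 ha.2.1, ?_⟩
        have : (s : ℕ) ≠ i := by
          intro hsi
          rw [Fin.ext hsi, hai] at ha
          exact one_ne_zero ha.2.2
        rw [add_unitBits_apply_of_ne _ this]
        exact ha.2.2
      rw [← shiftAll_eq_self hlow]
      exact shiftAll_mono l (hHX.trans Finset.subset_union_left)
    have h3 := (h2 (1 + unitBits m S)).symm
    refine absurd h3 (Finset.card_lt_card ⟨fun a ha => ?_, fun hsub => ?_⟩).ne
    · rw [Finset.mem_filter] at ha ⊢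
      refine ⟨?_, ha.2⟩
      by_cases hφa : φ a
      · rw [eq_spliceBits hφa ha.2] at ha
        exact absurd ha.1 hb'
      · exact (h1 a hφa).2 ha.1
    · refine hb' (Finset.mem_filter.1 (hsub (Finset.mem_filter.2
        ⟨hHZ (Finset.mem_filter.2 ⟨Finset.mem_univ _, ?_, ?_⟩), ?_⟩))).1
      · exact fun i hi => spliceBits_of_lt _ _ hi
      · rw [spliceBits_of_le _ _ (by simp [hs])]
        simp [unitBits, hs, CharTwo.add_self_eq_zero]
      · exact fun i hi => spliceBits_of_le _ _ hi

/-- If all transpositions among vectors with the same first `S ≤ m - 2` coordinates are symmetries,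
then all frozen bits lie in the first subcode or all information bits lie in the last one. -/
lemma compl_subset_or_subset_of_no_cut {m S : ℕ} (hS : S + 2 ≤ m) {I : Finset (Bits m)}
    (hI : IsMoveClosed I)
    (hswap : ∀ x y : Bits m, (∀ i : Fin m, (i : ℕ) < S → x i = y i) →
      Equiv.swap x y ∈ erasureSymm I) : Iᶜ ⊆ indTop m S 1 ∨ I ⊆ indTop m S 0 := by
  classical
  by_contra hcon
  rw [not_or, Finset.not_subset, Finset.not_subset] at hcon
  obtain ⟨⟨f, hfI, hf⟩, g, hgI, hg⟩ := hcon
  rw [Finset.mem_compl] at hfI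
  simp only [indTop, Finset.mem_filter, Finset.mem_univ, true_and, not_forall] at hf hg
  obtain ⟨jf, hjf, hfj⟩ := hf
  obtain ⟨jg, hjg, hgj⟩ := hg
  rw [← ne_eq, zmod_two_ne_one] at hfj
  rw [← ne_eq, zmod_two_ne_zero] at hgj
  set s : Fin m := ⟨S, by omega⟩ with hs
  -- The fibers of `I` are trivial: `T b` says that the fiber over `b` is full up to its largest
  -- point, and otherwise it is empty up to its smallest point.
  set T : Bits m → Prop := fun b => spliceBits S b (unitBits m S) ∈ I with hT
  have hTmem : ∀ a, T a → ∀ j : Fin m, S ≤ (j : ℕ) → a j = 0 → a ∈ I := by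
    intro a ha j hj haj
    have h1 := spliceBits_compl_mem (by omega) hI hswap ha
    by_cases hjs : j = s
    · refine hI.mem_of_le h1 fun k hk => ?_
      rcases lt_or_ge (k : ℕ) S with hkS | hkS
      · rwa [spliceBits_of_lt _ _ hkS]
      · rw [spliceBits_of_le _ _ hkS]
        have : (k : ℕ) ≠ S := by
          intro h
          rw [show k = j from hjs ▸ Fin.ext h, haj] at hk
          exact zero_ne_one hk
        simp [unitBits_apply_of_ne this]
    · have hjS : (j : ℕ) ≠ S := fun h => hjs (Fin.ext h)
      refine hI.mem_of_replace h1 (i := s) (j := j) (Fin.lt_def.2 (by simp [hs]; omega)) ?_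
        fun k hk => ?_
      · rw [spliceBits_of_le _ _ hj]
        simp [unitBits_apply_of_ne hjS]
      · by_cases hks : k = s
        · exact Or.inl hks
        · have hkS' : (k : ℕ) ≠ S := fun h => hks (Fin.ext h)
          refine Or.inr ⟨fun h => ?_, ?_⟩
          · rw [h, haj] at hk
            exact zero_ne_one hk
          · rcases lt_or_ge (k : ℕ) S with hkS | hkS
            · rwa [spliceBits_of_lt _ _ hkS]
            · rw [spliceBits_of_le _ _ hkS]
              simp [unitBits_apply_of_ne hkS']
  have hmemT : ∀ a ∈ I, ∀ j : Fin m, S ≤ (j : ℕ) → a j = 1 → T a := by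
    intro a ha j hj haj
    have hk1 : ∀ k : Fin m, spliceBits S a (unitBits m S) k = 1 →
        k = s ∨ ((k : ℕ) < S ∧ a k = 1) := by
      intro k hk
      rcases lt_or_ge (k : ℕ) S with hkS | hkS
      · rw [spliceBits_of_lt _ _ hkS] at hk
        exact Or.inr ⟨hkS, hk⟩
      · rw [spliceBits_of_le _ _ hkS] at hk
        left
        by_contra hne
        rw [unitBits_apply_of_ne fun h => hne (Fin.ext h)] at hk
        exact zero_ne_one hk
    by_cases hjs : j = s
    · refine hI.mem_of_le ha fun k hk => ?_
      rcases hk1 k hk with h | h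
      · rwa [h, ← hjs]
      · exact h.2
    · have hjS : (j : ℕ) ≠ S := fun h => hjs (Fin.ext h)
      refine hI.mem_of_replace ha (i := s) (j := j) (Fin.lt_def.2 (by simp [hs]; omega)) haj
        fun k hk => (hk1 k hk).imp_right fun h => ⟨?_, h.2⟩
      rintro rfl
      omega
  have hTg : T g := hmemT g hgI jg hjg hgj
  have hTf : ¬ T f := fun h => hfI (hTmem f h jf hjf hfj)
  have hTle : ∀ a b, T a → (∀ i : Fin m, (i : ℕ) < S → b i = 1 → a i = 1) → T b := by
    intro a b ha hab
    refine hI.mem_of_le ha fun k hk => ?_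
    rcases lt_or_ge (k : ℕ) S with hkS | hkS
    · rw [spliceBits_of_lt _ _ hkS] at hk ⊢
      exact hab k hkS hk
    · rwa [spliceBits_of_le _ _ hkS] at hk ⊢
  have hTrep : ∀ a b, T a → ∀ i j : Fin m, i < j → (j : ℕ) < S → a j = 1 →
      (∀ k, b k = 1 → k = i ∨ (k ≠ j ∧ a k = 1)) → T b := by
    intro a b ha i j hij hj haj hab
    refine hI.mem_of_replace ha hij (by rwa [spliceBits_of_lt _ _ hj]) fun k hk => ?_
    rcases lt_or_ge (k : ℕ) S with hkS | hkS
    · rw [spliceBits_of_lt _ _ hkS] at hk ⊢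
      exact hab k hk
    · rw [spliceBits_of_le _ _ hkS] at hk ⊢
      exact Or.inr ⟨fun h => by rw [h] at hkS; omega, hk⟩
  -- As `T` holds somewhere but not everywhere, it is not closed under setting the bit at `S - 1`.
  have hmax : ∃ b, T b ∧ ∀ b', T b' → (monoSupp b').card ≤ (monoSupp b).card := by
    obtain ⟨b, hb, hb'⟩ := Finset.exists_max_image (Finset.univ.filter T)
      (fun b => (monoSupp b).card) ⟨g, Finset.mem_filter.2 ⟨Finset.mem_univ _, hTg⟩⟩
    exact ⟨b, (Finset.mem_filter.1 hb).2, fun b' h =>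
      hb' b' (Finset.mem_filter.2 ⟨Finset.mem_univ _, h⟩)⟩
  have hgrow : ∀ (b : Bits m) (i : Fin m), b i = 0 →
      (monoSupp b).card < (monoSupp (b + unitBits m i)).card := by
    intro b i hbi
    refine Finset.card_lt_card ⟨fun k hk => ?_, fun hsub => ?_⟩
    · rw [mem_monoSupp] at hk ⊢
      rw [add_unitBits_apply_of_ne _ fun h => ?_, hk]
      rw [Fin.ext h, hbi] at hk
      exact zero_ne_one hk
    · have := hsub (mem_monoSupp.2 (show (b + unitBits m i) i = 1 by simp [hbi]))
      rw [mem_monoSupp, hbi] at this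
      exact zero_ne_one this
  -- Otherwise a vector `b` with `T b` of maximal weight would have bit `1` at `S - 1`; moving this
  -- bit to a position `i` with `b_i = 0` and setting it again would increase the weight.
  obtain ⟨r, hr, b, hTb, hbr, hTb'⟩ : ∃ r : Fin m, (r : ℕ) + 1 = S ∧
      ∃ b, T b ∧ b r = 0 ∧ ¬ T (b + unitBits m r) := by
    obtain ⟨b, hb, hbmax⟩ := hmax
    have hex : ∃ i : Fin m, (i : ℕ) < S ∧ f i = 1 ∧ b i ≠ 1 := by
      by_contra hne
      push Not at hne
      exact hTf (hTle b f hb hne)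
    obtain ⟨i, hiS, -, hbi⟩ := hex
    rw [zmod_two_ne_one] at hbi
    obtain ⟨r, hr⟩ : ∃ r : Fin m, (r : ℕ) + 1 = S := ⟨⟨S - 1, by omega⟩, by simp only; omega⟩
    refine ⟨r, hr, ?_⟩
    by_contra hclosed
    push Not at hclosed
    have hbr : b r = 1 := by
      rw [← zmod_two_ne_zero]
      intro h0
      exact absurd (hbmax _ (hclosed b hb h0)) (not_le.2 (hgrow b r h0))
    have hir : i ≠ r := by
      rintro rfl
      rw [hbi] at hbr
      exact zero_ne_one hbr
    have hir' : (i : ℕ) ≠ r := fun h => hir (Fin.ext h)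
    have hri' : (r : ℕ) ≠ i := fun h => hir (Fin.ext h.symm)
    have h1 : T (b + unitBits m i + unitBits m r) := by
      refine hTrep b _ hb i r (Fin.lt_def.2 (by omega)) (by omega) hbr fun k hk => ?_
      by_cases hki : k = i
      · exact Or.inl hki
      · by_cases hkr : k = r
        · rw [hkr, add_unitBits_apply_self, add_unitBits_apply_of_ne _ hri', hbr,
            CharTwo.add_self_eq_zero] at hk
          exact absurd hk zero_ne_one
        · rw [add_unitBits_apply_of_ne _ fun h => hkr (Fin.ext h),
            add_unitBits_apply_of_ne _ fun h => hki (Fin.ext h)] at hk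
          exact Or.inr ⟨hkr, hk⟩
    have h2 := hclosed _ h1 (by
      rw [add_unitBits_apply_self, add_unitBits_apply_of_ne _ hri', hbr,
        CharTwo.add_self_eq_zero])
    rw [bits_add_add_cancel] at h2
    exact absurd (hbmax _ h2) (not_le.2 (hgrow b i hbi))
  have hnot : ∀ a, (∀ i : Fin m, (i : ℕ) < S → a i = (b + unitBits m r) i) →
      ∀ j : Fin m, S ≤ (j : ℕ) → a j = 1 → a ∉ I := by
    intro a hab j hj haj ha
    exact hTb' (hTle a _ (hmemT a ha j hj haj) fun i hi hbi => by rw [hab i hi, hbi])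
  -- If the block has size at least `3`, the fiber over `b + e_r` has a further point.
  have hm : m = S + 2 := by
    by_contra hne
    set j : Fin m := ⟨S + 2, by omega⟩ with hj
    set i : Fin m := ⟨S + 1, by omega⟩ with hi
    have h1 := spliceBits_compl_mem (by omega) hI hswap hTb
    refine hnot (spliceBits S (b + unitBits m r) (unitBits m (S + 1)))
      (fun k hk => spliceBits_of_lt _ _ hk) i (by simp [hi])
      (by rw [spliceBits_of_le _ _ (by simp [hi])]; simp [unitBits, hi]) ?_
    refine hI.mem_of_replace h1 (i := r) (j := j) (Fin.lt_def.2 (by simp only [hj]; omega)) ?_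
      fun k hk => ?_
    · rw [spliceBits_of_le _ _ (by simp [hj])]
      simp [unitBits, hj]
    · rcases lt_or_ge (k : ℕ) S with hkS | hkS
      · rw [spliceBits_of_lt _ _ hkS] at hk ⊢
        by_cases hkr : k = r
        · exact Or.inl hkr
        · rw [add_unitBits_apply_of_ne _ fun h => hkr (Fin.ext h)] at hk
          refine Or.inr ⟨fun h => ?_, hk⟩
          rw [h] at hkS
          simp only [hj] at hkS
          omega
      · rw [spliceBits_of_le _ _ hkS] at hk ⊢
        have hkS1 : (k : ℕ) = S + 1 := by
          by_contra h
          rw [unitBits_apply_of_ne h] at hk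
          exact zero_ne_one hk
        refine Or.inr ⟨fun h => ?_, ?_⟩
        · rw [h] at hkS1
          simp only [hj] at hkS1
          omega
        · simp [unitBits_apply_of_ne (show (k : ℕ) ≠ S by omega)]
  -- In a block of size `2`, replacing the point `z` of `I` by its neighbour `z'` in direction `r`
  -- keeps the pattern decodable, as the down-shift in direction `r` undoes this.  Transposing `z'`
  -- with the point `w` of the same fiber gives a pattern that has lost a point of top part `(0, 1)`
  -- and is not decodable.
  set q : Fin m := ⟨S + 1, by omega⟩ with hq
  have htop : ∀ k : Fin m, S ≤ (k : ℕ) → k = s ∨ k = q := by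
    intro k hk
    have := k.2
    rcases Nat.lt_or_ge (k : ℕ) (S + 1) with h | h
    · exact Or.inl (Fin.ext (by simp only [hs]; omega))
    · exact Or.inr (Fin.ext (by simp only [hq]; omega))
  have hsq : (s : ℕ) ≠ q := by simp [hs, hq]
  have hrs : (r : ℕ) ≠ s := by simp only [hs]; omega
  have hrq : (r : ℕ) ≠ q := by simp only [hq]; omega
  set z := spliceBits S b (unitBits m q) with hz
  have hzs : z s = 0 := by
    rw [hz, spliceBits_of_le _ _ (by simp [hs]), unitBits_apply_of_ne hsq]
  have hzq : z q = 1 := by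
    rw [hz, spliceBits_of_le _ _ (by simp [hq]), unitBits_apply_self]
  have hzr : z r = 0 := by
    rw [hz, spliceBits_of_lt _ _ (by omega), hbr]
  have hzlow : ∀ i : Fin m, (i : ℕ) < S → z i = b i := fun i hi => spliceBits_of_lt _ _ hi
  have hzI : z ∈ I :=
    hTmem z (hTle b z hTb fun i hi h => by rwa [← hzlow i hi]) s (by simp [hs]) hzs
  set c := z + unitBits m r + unitBits m q with hc
  have hcr : c r = 1 := by
    rw [hc, add_unitBits_apply_of_ne _ hrq, add_unitBits_apply_self, hzr, zero_add]
  have hcq : c q = 0 := by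
    rw [hc, add_unitBits_apply_self, add_unitBits_apply_of_ne _ hrq.symm, hzq,
      CharTwo.add_self_eq_zero]
  have hcs : c s = 0 := by
    rw [hc, add_unitBits_apply_of_ne _ hsq, add_unitBits_apply_of_ne _ hrs.symm, hzs]
  have hclow : ∀ i : Fin m, (i : ℕ) < S → c i = (b + unitBits m r) i := by
    intro i hi
    rw [hc, add_unitBits_apply_of_ne _ (by simp only [hq]; omega), Pi.add_apply, hzlow i hi,
      Pi.add_apply]
  have hczr : ∀ k : Fin m, k ≠ r → k ≠ q → c k = z k := fun k h1 h2 => by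
    rw [hc, add_unitBits_apply_of_ne _ fun h => h2 (Fin.ext h),
      add_unitBits_apply_of_ne _ fun h => h1 (Fin.ext h)]
  have hcI : c ∈ I := by
    refine hI.mem_of_replace hzI (i := r) (j := q) (Fin.lt_def.2 (by simp only [hq]; omega)) hzq
      fun k hk => ?_
    by_cases hkr : k = r
    · exact Or.inl hkr
    · have hkq : k ≠ q := by
        rintro rfl
        rw [hcq] at hk
        exact zero_ne_one hk
      exact Or.inr ⟨hkq, by rwa [← hczr k hkr hkq]⟩
  set z' := c + unitBits m q with hz'
  have hzz' : z + unitBits m r = z' := by rw [hz', hc, bits_add_add_cancel]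
  set w := c + unitBits m s with hw
  have hz'r : z' r = 1 := by rw [hz', add_unitBits_apply_of_ne _ hrq, hcr]
  have hwr : w r = 1 := by rw [hw, add_unitBits_apply_of_ne _ hrs, hcr]
  have hz's : z' s = 0 := by rw [hz', add_unitBits_apply_of_ne _ hsq, hcs]
  have hz'q : z' q = 1 := by rw [hz', add_unitBits_apply_self, hcq, zero_add]
  have hws : w s = 1 := by rw [hw, add_unitBits_apply_self, hcs, zero_add]
  have hwq : w q = 0 := by rw [hw, add_unitBits_apply_of_ne _ hsq.symm, hcq]
  have hz'I : z' ∉ I := hnot z' (fun i hi => by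
    rw [hz', add_unitBits_apply_of_ne _ (by simp only [hq]; omega), hclow i hi]) q
    (by simp [hq]) hz'q
  have hwI : w ∉ I := hnot w (fun i hi => by
    rw [hw, add_unitBits_apply_of_ne _ (by simp only [hs]; omega), hclow i hi]) s
    (by simp [hs]) hws
  have hne : ∀ {x y : Bits m} {i : Fin m}, x i = 1 → y i = 0 → x ≠ y := by
    rintro x y i h1 h0 rfl
    rw [h0] at h1
    exact zero_ne_one h1
  have htopI : z + unitBits m s ∉ I := by
    intro h
    refine hwI (hI.mem_of_replace h (i := r) (j := q) (Fin.lt_def.2 (by simp only [hq]; omega))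
      (by rw [add_unitBits_apply_of_ne _ hsq.symm, hzq]) fun k hk => ?_)
    by_cases hkr : k = r
    · exact Or.inl hkr
    · have hkq : k ≠ q := by
        rintro rfl
        rw [hwq] at hk
        exact zero_ne_one hk
      refine Or.inr ⟨hkq, ?_⟩
      by_cases hks : k = s
      · rw [hks, add_unitBits_apply_self, hzs, zero_add]
      · rw [hw, add_unitBits_apply_of_ne _ fun h => hks (Fin.ext h), hczr k hkr hkq] at hk
        rwa [add_unitBits_apply_of_ne _ fun h => hks (Fin.ext h)]
  set l := List.range' S (m - S) with hl
  have hlow : ∀ i : Fin m, S ≤ (i : ℕ) → c i = 0 →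
      (∀ k : Fin m, S ≤ (k : ℕ) → k ≠ i → (c + unitBits m i) k = 0) →
      IsLowerIn l (insert (c + unitBits m i) (I.erase z)) := by
    intro i hi hci h0 k hk a ha hak
    have hkS : S ≤ (k : ℕ) := (List.mem_range'_1.1 hk).1
    rw [Finset.mem_insert, Finset.mem_erase] at ha ⊢
    right
    rcases ha with rfl | ⟨haz, haI⟩
    · have hki : k = i := by
        by_contra hne'
        rw [h0 k hkS hne'] at hak
        exact zero_ne_one hak
      rw [hki, bits_add_add_cancel]
      exact ⟨hne hcr hzr, hcI⟩
    · refine ⟨fun h => ?_, hI.isLowerIn [(k : ℕ)] k (by simp) a haI hak⟩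
      rcases htop k hkS with rfl | rfl
      · rw [← h, bits_add_add_cancel] at htopI
        exact htopI haI
      · have := congrFun h q
        rw [add_unitBits_apply_self, hak, hzq, CharTwo.add_self_eq_zero] at this
        exact zero_ne_one this
  have hlow2 : IsLowerIn l (insert z' (I.erase z)) := by
    refine hlow q (by simp [hq]) hcq fun k hk hkq => ?_
    rcases htop k hk with rfl | rfl
    · exact hz's
    · exact absurd rfl hkq
  have hlow3 : IsLowerIn l (insert w (I.erase z)) := by
    refine hlow s (by simp [hs]) hcs fun k hk hks => ?_
    rcases htop k hk with rfl | rfl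
    · exact absurd rfl hks
    · exact hwq
  have hgood : I ⊆ unerased (insert z' (I.erase z)) := by
    rw [unerased_eq_shiftAll_shiftAll (by omega : S ≤ m), shiftAll_eq_self hlow2, ← hr,
      List.range_succ, shiftAll_append]
    have hsub : I ⊆ downShift r (insert z' (I.erase z)) := by
      intro a ha
      rcases zmod_two_cases (a r) with h0 | h0
      · rw [mem_downShift_of_zero h0]
        by_cases haz : a = z
        · right
          rw [haz, hzz']
          exact Finset.mem_insert_self _ _
        · exact Or.inl (Finset.mem_insert_of_mem (Finset.mem_erase.2 ⟨haz, ha⟩))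
      · rw [mem_downShift_of_one h0]
        refine ⟨Finset.mem_insert_of_mem (Finset.mem_erase.2 ⟨hne h0 hzr, ha⟩),
          Finset.mem_insert_of_mem (Finset.mem_erase.2 ⟨fun h => ?_,
            hI.isLowerIn [(r : ℕ)] r (by simp) a ha h0⟩)⟩
        rw [← hzz', ← h, bits_add_add_cancel] at hz'I
        exact hz'I ha
    calc I = shiftAll (List.range r) I := (shiftAll_eq_self (hI.isLowerIn _)).symm
      _ ⊆ _ := shiftAll_mono _ hsub
  have hpull : pullback (Equiv.swap z' w) (insert z' (I.erase z)) = insert w (I.erase z) := by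
    have hz'w : z' ≠ w := hne hz'q hwq
    ext a
    rw [mem_pullback]
    by_cases ha : a = z'
    · subst ha
      simp [hz'w, hz'w.symm, hz'I, hwI]
    · by_cases ha' : a = w
      · subst ha'; simp
      · rw [Equiv.swap_apply_of_ne_of_ne ha ha']
        simp [ha, ha']
  have hgood' : I ⊆ unerased (insert w (I.erase z)) := by
    rw [← hpull, hswap z' w fun i hi => ?_]
    · exact hgood
    · rw [hz', hw, add_unitBits_apply_of_ne _ (by simp only [hq]; omega),
        add_unitBits_apply_of_ne _ (by simp only [hs]; omega)]
  rw [unerased_eq_shiftAll_shiftAll (by omega : S ≤ m), shiftAll_eq_self hlow3] at hgood'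
  have h1 := Finset.card_le_card (Finset.filter_subset_filter (fun a => a s = 0 ∧ a q = 1) hgood')
  rw [card_filter_shiftAll] at h1
  · refine absurd h1 (not_le.2 (Finset.card_lt_card ⟨fun a ha => ?_, fun hsub => ?_⟩))
    · rw [Finset.mem_filter, Finset.mem_insert] at ha
      rcases ha with ⟨rfl | ha, ha'⟩
      · rw [hws] at ha'
        exact absurd ha'.1 one_ne_zero
      · exact Finset.mem_filter.2 ⟨(Finset.mem_erase.1 ha).2, ha'⟩
    · have := hsub (Finset.mem_filter.2 ⟨hzI, hzs, hzq⟩)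
      rw [Finset.mem_filter, Finset.mem_insert] at this
      rcases this.1 with h | h
      · exact hne hwr hzr h.symm
      · exact (Finset.mem_erase.1 h).1 rfl
  · intro t ht a
    rw [List.mem_range] at ht
    rw [add_unitBits_apply_of_ne _ (by simp only [hs]; omega),
      add_unitBits_apply_of_ne _ (by simp only [hq]; omega)]

/-! ### Passing to subcodes -/

lemma fillTop_zero_add {m S : ℕ} (b b' : Bits S) :
    fillTop m 0 (b + b') = fillTop m 0 b + fillTop m 0 b' := by
  funext i
  by_cases hi : (i : ℕ) < S <;> simp [fillTop, hi]

lemma lowBits_map_fillTop {m S : ℕ} (hS : S ≤ m) (π : Bits m ≃+ Bits m) (hcut : IsCut π S)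
    (a : Bits m) : lowBits hS (π (fillTop m 0 (lowBits hS a))) = lowBits hS (π a) := by
  have h0 : ∀ i : Fin m, (i : ℕ) < S → π (fillTop m 0 (lowBits hS a) - a) i = 0 := by
    refine hcut _ fun i hi => ?_
    rw [Pi.sub_apply, fillTop_apply_of_lt _ _ hi]
    exact sub_self (a i)
  funext i
  have h1 := h0 (Fin.castLE hS i) (by simp)
  rw [map_sub, Pi.sub_apply, sub_eq_zero] at h1
  exact h1

/-- The permutation of `𝔽₂^S` that a linear permutation `π` with a cut at `S` induces on the first
`S` coordinates. -/
noncomputable def lowPart {m S : ℕ} (hS : S ≤ m) (π : Bits m ≃+ Bits m) (hcut : IsCut π S) :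
    Bits S ≃+ Bits S :=
  AddEquiv.ofBijective
    (AddMonoidHom.mk' (fun b => lowBits hS (π (fillTop m 0 b))) fun b b' => by
      rw [fillTop_zero_add, map_add, lowBits_add])
    (by
      refine Function.Surjective.bijective_of_finite fun b => ?_
      refine ⟨lowBits hS (π.symm (fillTop m 0 b)), ?_⟩
      exact (lowBits_map_fillTop hS π hcut _).trans
        (by rw [AddEquiv.apply_symm_apply, lowBits_fillTop]))

lemma lowPart_lowBits {m S : ℕ} (hS : S ≤ m) (π : Bits m ≃+ Bits m) (hcut : IsCut π S)
    (a : Bits m) : lowPart hS π hcut (lowBits hS a) = lowBits hS (π a) :=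
  lowBits_map_fillTop hS π hcut a

lemma isCut_lowPart_iff {m S : ℕ} (hS : S ≤ m) (π : Bits m ≃+ Bits m) (hcut : IsCut π S) {p : ℕ}
    (hp : p ≤ S) : IsCut (lowPart hS π hcut) p ↔ IsCut π p := by
  constructor
  · intro h x hx i hi
    have := h (lowBits hS x) (fun k hk => hx _ hk) ⟨i, by omega⟩ hi
    rw [lowPart_lowBits] at this
    exact this
  · intro h x hx i hi
    refine h (fillTop m 0 x) (fun k hk => ?_) (Fin.castLE hS i) hi
    rw [fillTop_apply_of_lt _ _ (by omega)]
    exact hx _ hk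

/-- Received sets that are unions of fibers test the subcode that is decoded last. -/
lemma subset_unerased_cylinder {m S : ℕ} (hS : S ≤ m) {I : Finset (Bits m)} (hI : IsMoveClosed I)
    (A : Finset (Bits S)) : I ⊆ unerased (Finset.univ.filter fun a : Bits m => lowBits hS a ∈ A) ↔
      subInfo S 0 I ⊆ unerased A := by
  have hlow : IsLowerIn (List.range' S (m - S))
      (Finset.univ.filter fun a : Bits m => lowBits hS a ∈ A) := by
    intro i hi a ha _
    rw [Finset.mem_filter] at ha ⊢
    refine ⟨Finset.mem_univ _, ?_⟩
    rw [lowBits_add_unitBits_of_le hS (List.mem_range'_1.1 hi).1]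
    exact ha.2
  have hcyl := shiftAll_cylinder hS (l := List.range S) (by simp) A (fun _ => False) (by simp)
  simp only [or_false] at hcyl
  rw [unerased_eq_shiftAll_shiftAll hS, shiftAll_eq_self hlow, hcyl]
  constructor
  · intro h b hb
    have := (Finset.mem_filter.1 (h (subInfo_mem.1 hb))).2
    rwa [lowBits_fillTop] at this
  · intro h a ha
    refine Finset.mem_filter.2 ⟨Finset.mem_univ _,
      h (subInfo_mem.2 (hI.mem_of_le ha fun i hi => ?_))⟩
    rcases lt_or_ge (i : ℕ) S with hiS | hiS
    · rwa [fillTop_apply_of_lt _ _ hiS] at hi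
    · rw [fillTop_apply_of_le _ _ hiS] at hi
      exact absurd hi zero_ne_one

/-- The set of received positions whose fiber over each `b ∈ A` is full, and whose fiber over `b ∉ A`
misses only the point with the last coordinates of `q b`. -/
def puncturedCylinder {m S : ℕ} (hS : S ≤ m) (A : Finset (Bits S)) (q : Bits S → Bits m) :
    Finset (Bits m) :=
  Finset.univ.filter fun a => lowBits hS a ∈ A ∨ ∃ i : Fin m, S ≤ (i : ℕ) ∧ a i ≠ q (lowBits hS a) i

/-- Down-shifts move the missing point of each fiber upwards. -/
lemma shiftAll_puncturedCylinder {m S : ℕ} (hS : S ≤ m) (A : Finset (Bits S)) (q : Bits S → Bits m)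
    {l : List ℕ} (hl : ∀ t ∈ l, S ≤ t) : shiftAll l (puncturedCylinder hS A q) =
      puncturedCylinder hS A fun b i => if (i : ℕ) ∈ l then 1 else q b i := by
  induction l with
  | nil => simp [shiftAll]
  | cons t l ih =>
    rw [shiftAll_cons, ih fun s hs => hl s (List.mem_cons_of_mem _ hs)]
    have htS := hl t (by simp)
    rcases le_or_gt m t with ht | ht
    · rw [downShift_of_le ht]
      congr 1
      funext b i
      have : (i : ℕ) ≠ t := by omega
      simp [this]
    set j : Fin m := ⟨t, ht⟩ with hj
    set q' : Bits S → Bits m := fun b i => if (i : ℕ) ∈ l then 1 else q b i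
    have hq' : (fun (b : Bits S) (i : Fin m) => if (i : ℕ) ∈ t :: l then 1 else q b i) =
        fun b i => if i = j then 1 else q' b i := by
      funext b i
      by_cases h : i = j
      · simp [h, hj]
      · have : (i : ℕ) ≠ t := fun h' => h (Fin.ext h')
        simp [h, this, q']
    rw [hq']
    ext a
    change a ∈ downShift (j : ℕ) _ ↔ _
    rcases zmod_two_cases (a j) with h0 | h0
    · -- The right side contains the half-space `a_j = 0`, and a line misses at most one point.
      rw [mem_downShift_of_zero h0]
      refine ⟨fun _ => Finset.mem_filter.2 ⟨Finset.mem_univ _, Or.inr ⟨j, htS, by simp [h0]⟩⟩,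
        fun _ => ?_⟩
      rcases zmod_two_cases (q' (lowBits hS a) j) with h1 | h1
      · right
        refine Finset.mem_filter.2 ⟨Finset.mem_univ _, Or.inr ⟨j, htS, ?_⟩⟩
        rw [lowBits_add_unitBits_of_le hS (by exact htS), h1, add_unitBits_apply_self, h0, zero_add]
        exact one_ne_zero
      · left
        refine Finset.mem_filter.2 ⟨Finset.mem_univ _, Or.inr ⟨j, htS, ?_⟩⟩
        rw [h1, h0]
        exact zero_ne_one
    · rw [mem_downShift_of_one h0]
      simp only [puncturedCylinder, Finset.mem_filter, Finset.mem_univ, true_and,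
        lowBits_add_unitBits_of_le hS (show S ≤ (j : ℕ) from htS)]
      rw [← or_and_left]
      refine or_congr_right ?_
      set c := q' (lowBits hS a)
      constructor
      · rintro ⟨⟨i, hi, hai⟩, k, hk, hak⟩
        by_cases hij : i = j
        · by_cases hkj : k = j
          · rw [hkj, add_unitBits_apply_self, h0, CharTwo.add_self_eq_zero] at hak
            rw [hij, h0] at hai
            rcases zmod_two_cases (c j) with h | h
            · exact absurd h.symm hak
            · exact absurd h.symm hai
          · rw [add_unitBits_apply_of_ne _ fun h => hkj (Fin.ext h)] at hak
            exact ⟨k, hk, by simpa [hkj] using hak⟩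
        · exact ⟨i, hi, by simpa [hij] using hai⟩
      · rintro ⟨i, hi, hai⟩
        have hij : i ≠ j := by
          rintro rfl
          simp [h0] at hai
        simp only [hij, if_false] at hai
        refine ⟨⟨i, hi, hai⟩, i, hi, ?_⟩
        rwa [add_unitBits_apply_of_ne _ fun h => hij (Fin.ext h)]

/-- Received sets that miss at most one point of each fiber test the subcode that is decoded
first. -/
lemma subset_unerased_puncturedCylinder {m S : ℕ} (hS : S ≤ m) (I : Finset (Bits m))
    (A : Finset (Bits S)) (q : Bits S → Bits m) :
    I ⊆ unerased (puncturedCylinder hS A q) ↔ subInfo S 1 I ⊆ unerased A := by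
  have h1 : shiftAll (List.range' S (m - S)) (puncturedCylinder hS A q) =
      Finset.univ.filter fun a : Bits m =>
        lowBits hS a ∈ A ∨ ∃ i : Fin m, S ≤ (i : ℕ) ∧ a i ≠ 1 := by
    rw [shiftAll_puncturedCylinder hS A q fun t ht => (List.mem_range'_1.1 ht).1]
    refine Finset.filter_congr fun a _ => or_congr_right (exists_congr fun i =>
      and_congr_right fun hi => ?_)
    have : (i : ℕ) ∈ List.range' S (m - S) := List.mem_range'_1.2 ⟨hi, by have := i.2; omega⟩
    simp only [if_pos this]
  rw [unerased_eq_shiftAll_shiftAll hS, h1, shiftAll_cylinder hS (by simp)]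
  · constructor
    · intro h b hb
      rcases (Finset.mem_filter.1 (h (subInfo_mem.1 hb))).2 with h2 | ⟨i, hi, h2⟩
      · rwa [lowBits_fillTop] at h2
      · exact absurd (fillTop_apply_of_le _ _ hi) h2
    · intro h a ha
      rw [Finset.mem_filter]
      refine ⟨Finset.mem_univ _, or_iff_not_imp_right.2 fun h2 => ?_⟩
      push Not at h2
      refine h (subInfo_mem.2 ?_)
      have : fillTop m 1 (lowBits hS a) = a := by
        funext i
        rcases lt_or_ge (i : ℕ) S with hi | hi
        · rw [fillTop_apply_of_lt _ _ hi]; rfl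
        · rw [fillTop_apply_of_le _ _ hi, h2 i hi]
      rwa [this]
  · intro t ht a
    rw [List.mem_range] at ht
    refine exists_congr fun i => and_congr_right fun hi => ?_
    rw [add_unitBits_apply_of_ne _ (by omega)]

lemma lowPart_mem_erasureSymm_zero {m S : ℕ} (hS : S ≤ m) {I : Finset (Bits m)}
    (hI : IsMoveClosed I) {π : Bits m ≃+ Bits m} (hπ : π.toEquiv ∈ erasureSymm I)
    (hcut : IsCut π S) : (lowPart hS π hcut).toEquiv ∈ erasureSymm (subInfo S 0 I) := by
  intro A
  rw [← subset_unerased_cylinder hS hI, ← subset_unerased_cylinder hS hI]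
  have : (Finset.univ.filter fun a : Bits m =>
      lowBits hS a ∈ pullback (lowPart hS π hcut).toEquiv A) =
      pullback π.toEquiv (Finset.univ.filter fun a : Bits m => lowBits hS a ∈ A) := by
    ext a
    simp [lowPart_lowBits]
  rw [this, hπ]

lemma lowPart_mem_erasureSymm_one {m S : ℕ} (hS : S ≤ m) {I : Finset (Bits m)}
    {π : Bits m ≃+ Bits m} (hπ : π.toEquiv ∈ erasureSymm I)
    (hcut : IsCut π S) : (lowPart hS π hcut).toEquiv ∈ erasureSymm (subInfo S 1 I) := by
  intro A
  -- The point of the fiber over `b` that `π` maps to a point with top part `1`.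
  set q : Bits S → Bits m := fun b => π.symm (fillTop m 1 (lowPart hS π hcut b)) with hq
  have hqlow : ∀ b, lowBits hS (q b) = b := by
    intro b
    apply (lowPart hS π hcut).injective
    rw [lowPart_lowBits, hq]
    simp only [AddEquiv.apply_symm_apply, lowBits_fillTop]
  rw [← subset_unerased_puncturedCylinder hS I A fun _ => 1,
    ← subset_unerased_puncturedCylinder hS I _ q]
  have : puncturedCylinder hS (pullback (lowPart hS π hcut).toEquiv A) q =
      pullback π.toEquiv (puncturedCylinder hS A fun _ => 1) := by
    ext a
    have h1 : (∀ i : Fin m, S ≤ (i : ℕ) → π a i = 1) ↔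
        ∀ i : Fin m, S ≤ (i : ℕ) → a i = q (lowBits hS a) i := by
      constructor
      · intro h i _
        have : π a = fillTop m 1 (lowPart hS π hcut (lowBits hS a)) := by
          rw [lowPart_lowBits]
          funext k
          rcases lt_or_ge (k : ℕ) S with hk | hk
          · rw [fillTop_apply_of_lt _ _ hk]; rfl
          · rw [fillTop_apply_of_le _ _ hk, h k hk]
        rw [hq]
        simp only [← this, AddEquiv.symm_apply_apply]
      · intro h i hi
        have : a = q (lowBits hS a) := by
          funext k
          rcases lt_or_ge (k : ℕ) S with hk | hk
          · exact (congrFun (hqlow (lowBits hS a)) ⟨k, hk⟩).symm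
          · exact h k hk
        rw [this, hq]
        simp only [AddEquiv.apply_symm_apply]
        exact fillTop_apply_of_le _ _ hi
    have h2 := not_congr h1
    push Not at h2
    simp only [puncturedCylinder, mem_pullback, Finset.mem_filter, Finset.mem_univ, true_and,
      AddEquiv.toEquiv_eq_coe, EquivLike.coe_coe, lowPart_lowBits, Pi.one_apply, h2]
  rw [this, hπ]

/-! ### The decision algorithm -/

/-- A linear symmetry of the decoding condition whose cuts are given by the block sizes is accepted
by the decision algorithm. -/
theorem decAutRev_eq_true (r : List ℕ) (m : ℕ) (I : Finset (Bits m)) (π : Bits m ≃+ Bits m)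
    (hI : IsMoveClosed I) (hπ : π.toEquiv ∈ erasureSymm I) (hpos : ∀ k ∈ r, 0 < k)
    (hsum : r.sum = m) (hcut : ∀ p ≤ m, IsCut π p ↔ ∃ t, t <:+ r ∧ t.sum = p) :
    decAutRev r m I = true := by
  induction r generalizing m with
  | nil => rfl
  | cons k r ih =>
    rw [List.sum_cons] at hsum
    have hk := hpos k (by simp)
    have hgap : ∀ p, r.sum < p → p < m → ¬ IsCut π p := by
      intro p hp hpm h
      obtain ⟨t, ht, rfl⟩ := (hcut p hpm.le).1 h
      rcases List.suffix_cons_iff.1 ht with rfl | ht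
      · rw [List.sum_cons] at hpm
        omega
      · exact absurd (ht.sublist.sum_le_sum fun _ _ => Nat.zero_le _) (not_le.2 hp)
    have hmain : k ≠ 1 → Iᶜ ⊆ indTop m r.sum 1 ∨ I ⊆ indTop m r.sum 0 := fun hk1 =>
      compl_subset_or_subset_of_no_cut (by omega) hI fun x y hxy =>
        swap_mem_erasureSymm (by omega) I π hπ hgap hxy
    cases r with
    | nil =>
      rw [decAutRev, decide_eq_true_eq]
      by_cases hk1 : k = 1
      · rw [or_iff_not_imp_right, Finset.not_subset]
        rintro ⟨x, hxI, -⟩ z hz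
        rw [indTop, Finset.mem_filter]
        refine ⟨Finset.mem_univ _, fun i _ => zmod_two_ne_zero.1 fun h0 => ?_⟩
        refine Finset.mem_compl.1 hz (hI.mem_of_le hxI fun j hj => ?_)
        have hm : m = 1 := by simpa [hk1] using hsum.symm
        rw [show j = i from Fin.ext (by omega), h0] at hj
        exact absurd hj zero_ne_one
      · exact hmain hk1
    | cons k' r =>
      have hS : (k' :: r).sum ≤ m := by omega
      have hcutS : IsCut π (k' :: r).sum := (hcut _ hS).2 ⟨_, List.suffix_cons _ _, rfl⟩
      have hrec : ∀ c, (lowPart hS π hcutS).toEquiv ∈ erasureSymm (subInfo (k' :: r).sum c I) →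
          decAutRev (k' :: r) (k' :: r).sum (subInfo (k' :: r).sum c I) = true := by
        intro c hc
        refine ih _ _ (lowPart hS π hcutS) (hI.subInfo hS c) hc
          (fun j hj => hpos j (List.mem_cons_of_mem _ hj)) rfl fun p hp => ?_
        rw [isCut_lowPart_iff hS π hcutS hp, hcut p (hp.trans hS)]
        refine exists_congr fun t => ⟨fun ⟨h1, h2⟩ => ⟨?_, h2⟩, fun ⟨h1, h2⟩ =>
          ⟨h1.trans (List.suffix_cons _ _), h2⟩⟩
        rcases List.suffix_cons_iff.1 h1 with rfl | h1
        · rw [List.sum_cons] at h2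
          omega
        · exact h1
      have h1 := hrec 1 (lowPart_mem_erasureSymm_one hS hπ hcutS)
      have h0 := hrec 0 (lowPart_mem_erasureSymm_zero hS hI hπ hcutS)
      rw [decAutRev]
      split_ifs with hk1 hF hI0
      · rw [h1, h0]; rfl
      · exact h1
      · exact h0
      · exact absurd (hmain hk1) (by tauto)

/-! ### Block structure and cuts -/

/-- The map `a ↦ M a` as an additive automorphism. -/
def phiAdd {m : ℕ} (M : GL (Fin m) (ZMod 2)) : Bits m ≃+ Bits m :=
  { phi M with map_add' := fun a b => Matrix.mulVec_add _ a b }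

lemma phiAdd_apply {m : ℕ} (M : GL (Fin m) (ZMod 2)) (a : Bits m) :
    phiAdd M a = (M : Matrix (Fin m) (Fin m) (ZMod 2)).mulVec a := rfl

lemma isCut_phiAdd_iff {m : ℕ} (M : GL (Fin m) (ZMod 2)) (p : ℕ) :
    IsCut (phiAdd M) p ↔ ∀ i j : Fin m, (i : ℕ) < p → p ≤ (j : ℕ) →
      (M : Matrix (Fin m) (Fin m) (ZMod 2)) i j = 0 := by
  constructor
  · intro h i j hi hj
    have := h (Pi.single j 1) (fun k hk => Pi.single_eq_of_ne (by rintro rfl; omega) _) i hi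
    rwa [phiAdd_apply, Matrix.mulVec_single_one] at this
  · intro h x hx i hi
    rw [phiAdd_apply, Matrix.mulVec, dotProduct]
    refine Finset.sum_eq_zero fun j _ => ?_
    rcases lt_or_ge (j : ℕ) p with hj | hj
    · rw [hx j hj, mul_zero]
    · rw [h i j hi hj, zero_mul]

/-- The diagonal blocks of an invertible block lower-triangular matrix are invertible. -/
lemma det_diagBlock_ne_zero {k q : ℕ} (hq : q ≤ k) (B : Matrix (Fin k) (Fin k) (ZMod 2))
    (hB : ∀ i j : Fin k, (i : ℕ) < q → q ≤ (j : ℕ) → B i j = 0) (hdet : B.det ≠ 0) :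
    (diagBlock B 0 q).det ≠ 0 ∧ (diagBlock B q (k - q)).det ≠ 0 := by
  obtain ⟨q', rfl⟩ := Nat.exists_eq_add_of_le hq
  rw [Nat.add_sub_cancel_left]
  have h : B.submatrix finSumFinEquiv finSumFinEquiv =
      Matrix.fromBlocks (diagBlock B 0 q) 0
        (B.submatrix (Fin.natAdd q) (Fin.castAdd q')) (diagBlock B q q') := by
    ext i j
    rcases i with i | i <;> rcases j with j | j
    · have hi : (i : ℕ) < q + q' := by omega
      have hj : (j : ℕ) < q + q' := by omega
      simp only [Matrix.submatrix_apply, finSumFinEquiv_apply_left, Matrix.fromBlocks_apply₁₁,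
        diagBlock, zero_add, hi, hj, and_self, dif_pos]
      rfl
    · simpa using hB _ _ (by simp) (by simp)
    · rfl
    · have hi : q + (i : ℕ) < q + q' := by omega
      have hj : q + (j : ℕ) < q + q' := by omega
      simp only [Matrix.submatrix_apply, finSumFinEquiv_apply_right, Matrix.fromBlocks_apply₂₂,
        diagBlock, hi, hj, and_self, dif_pos]
      rfl
  rw [← Matrix.det_submatrix_equiv_self finSumFinEquiv, h, Matrix.det_fromBlocks_zero₁₂] at hdet
  exact mul_ne_zero_iff.1 hdet

/-- A cut that is not a partial sum of the block sizes would split one of the diagonal blocks. -/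
lemma exists_take_sum_eq_of_cut {m : ℕ} {s : List ℕ} {M : Matrix (Fin m) (Fin m) (ZMod 2)}
    (hs : HasBlockStructure M s) {p : ℕ} (hp : p ≤ m)
    (hcut : ∀ i j : Fin m, (i : ℕ) < p → p ≤ (j : ℕ) → M i j = 0) :
    ∃ n ≤ s.length, (s.take n).sum = p := by
  obtain ⟨⟨hpos, hsum, -, hdet⟩, hirr⟩ := hs
  by_contra hno
  push Not at hno
  have hlt : ∀ n ≤ s.length, (s.take n).sum < p := by
    intro n
    induction n with
    | zero =>
      intro _
      have := hno 0 (by omega)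
      simp only [List.take_zero, List.sum_nil] at this ⊢
      omega
    | succ n ih =>
      intro hn
      have hP := ih (by omega)
      have hnext : (s.take (n + 1)).sum = (s.take n).sum + s.get ⟨n, hn⟩ := by
        rw [List.sum_take_succ _ _ hn]; rfl
      by_contra hge
      have hne := hno (n + 1) hn
      set P := (s.take n).sum with hPdef
      set k := s.get ⟨n, hn⟩ with hkdef
      have hle : P + k ≤ m := by
        rw [← hnext, ← hsum]
        exact (List.take_sublist (n + 1) s).sum_le_sum fun _ _ => Nat.zero_le _
      have hBcut : ∀ i j : Fin k, (i : ℕ) < p - P → p - P ≤ (j : ℕ) → diagBlock M P k i j = 0 := by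
        intro i j hi hj
        have hij : P + (i : ℕ) < m ∧ P + (j : ℕ) < m := by omega
        rw [diagBlock, dif_pos hij]
        exact hcut _ _ (by simp only; omega) (by simp only; omega)
      have hB := det_diagBlock_ne_zero (by omega) _ hBcut (hdet ⟨n, hn⟩)
      have := hirr ⟨n, hn⟩ [p - P, k - (p - P)] ⟨?_, ?_, ?_, ?_⟩
      · simp at this
      · intro x hx
        rcases List.mem_pair.1 hx with rfl | rfl <;> omega
      · simp only [List.sum_cons, List.sum_nil]
        change p - P + (k - (p - P) + 0) = k
        omega
      · intro t ht i j hi hj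
        have hjk : (j : ℕ) < k := j.2
        rcases t with _ | _ | _ | t
        · simp at hi
        · simp only [List.take_succ_cons, List.take_zero, List.sum_cons, List.sum_nil] at hi hj
          exact hBcut i j (by omega) (by omega)
        · simp only [List.take_succ_cons, List.take_zero, List.sum_cons, List.sum_nil] at hi hj
          omega
        · simp at ht
      · intro t
        match t with
        | ⟨0, _⟩ => exact hB.1
        | ⟨1, _⟩ => exact hB.2
  have := hlt s.length le_rfl
  rw [List.take_length, hsum] at this
  omega

/-- The cuts of `φ(M)` are the partial sums of the block sizes of `M`, that is, the sums of the
suffixes of the reversed list, which are the lists met by the decision algorithm. -/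
lemma isCut_phiAdd_iff_exists_suffix {m : ℕ} {s : List ℕ} {M : GL (Fin m) (ZMod 2)}
    (hs : HasBlockStructure (M : Matrix (Fin m) (Fin m) (ZMod 2)) s) {p : ℕ} (hp : p ≤ m) :
    IsCut (phiAdd M) p ↔ ∃ t, t <:+ s.reverse ∧ t.sum = p := by
  rw [isCut_phiAdd_iff]
  constructor
  · intro h
    obtain ⟨n, -, hn⟩ := exists_take_sum_eq_of_cut hs hp h
    exact ⟨(s.take n).reverse, List.reverse_suffix.2 (List.take_prefix n s), by
      rw [List.sum_reverse, hn]⟩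
  · rintro ⟨t, ht, rfl⟩
    have ht' : t.reverse <+: s := by
      rw [← List.reverse_suffix, List.reverse_reverse]; exact ht
    have h1 := List.prefix_iff_eq_take.1 ht'
    have h2 := hs.1.2.2.1 t.reverse.length ht'.length_le
    rw [← h1, List.sum_reverse] at h2
    exact h2

theorem theorem2 (m : ℕ) (I : Finset (Bits m)) (hI : IsDecreasing I)
    (M : GL (Fin m) (ZMod 2)) (s : List ℕ)
    (hs : HasBlockStructure (M : Matrix (Fin m) (Fin m) (ZMod 2)) s)
    (hM : IsCodeAutomorphism (polarCode I) (phi M)) :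
    (CommutesWithSC I (phi M) → DecAut s I = true) ∧
      (AECommutesWithSC I (phi M) → DecAut s I = true) := by
  have key : AECommutesWithSC I (phi M) → DecAut s I = true := fun h =>
    decAutRev_eq_true s.reverse m I (phiAdd M) hI.isMoveClosed
      (mem_erasureSymm_of_dense I (phi M) (Measure.dense_of_ae h))
      (fun k hk => hs.1.1 k (List.mem_reverse.1 hk)) (by rw [List.sum_reverse, hs.1.2.1])
      fun p hp => isCut_phiAdd_iff_exists_suffix hs hp
  exact ⟨fun h => key (Filter.Eventually.of_forall h), key⟩
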